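/- There are $n$ boxes with hidden rewards $X_1,\dots,X_n$ drawn i.i.d. from a distribution $\mathcal D$. Given standard deviations $\boldsymbol\sigma=(\sigma_1,\dots,\sigma_n)\in\mathbb R_{\ge 0}^n$, one observes $\boldsymbol\sigma$ and $Y_i=X_i+\epsilon_i$, where $\epsilon_i\sim\mathcal N(0,\sigma_i^2)$ and all $X_i,\epsilon_i$ are independent. A policy maps $(\boldsymbol\sigma,\boldsymbol y)$ to a probability distribution over boxes, and $R_A(\mathcal D,\boldsymbol\sigma)$ is the expected reward of the box selected by the policy $A$. For a function $\gamma:\mathbb R^n\times\mathbb R^n\to\mathbb R$, a linear policy $\mathsf{Linear}_\gamma$ selects a box $i$ maximizing $y_i-\gamma(\boldsymbol\sigma,\boldsymbol y)\,\sigma_i$ (ties broken in any way). The optimal policy selects the box with the largest $\mathbb E[X_i\mid Y_i=y_i]$, so $R_{\mathsf{Opt}_{\mathcal D}}(\mathcal D,\boldsymbol\sigma)=\mathbb E\big[\max_i\mathbb E[X_i\mid Y_i]\big]$. Write $\mathbb E[\mathcal D]$ for the mean of $\mathcal D$ and $\mathbb E[\mathcal D_{m:m}]$ for the expected maximum of $m$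 i.i.d. draws from $\mathcal D$. The distribution $\mathcal D$ is MHR if it is supported on $[0,\infty)$ and has a density $f$ such that, with $F$ its cumulative distribution function, $(1-F)/f$ is non-increasing. For $c\in(0,1]$, the MHR small-noise condition with parameter $c$ says that $0\le\sigma_1\le\dots\le\sigma_n$ and $$\sigma_{\lceil n^c\rceil}\le\frac{\mathbb E[\mathcal D_{m:m}]}{18\sqrt{2c\ln n}},\qquad m=\lfloor n^c\rfloor.$$ **Theorem.** There are absolute constants $C,\kappa>0$ and $n_0$ such that the following hold. 1. For every MHR distribution $\mathcal D$ and every $n\ge n_0$ there is a vector $\boldsymbol\sigma^*$ that satisfies the MHR small-noise condition with $c=1/5626$ and such that, for every function $\gamma:\mathbb R^n\times\mathbb R^n\to\mathbb R$, $$R_{\mathsf{Linear}_\gamma}(\mathcal D,\boldsymbol\sigma^*)\le C\,\frac{\mathbb E[\mathcal D]}{\mathbb E[\mathcal D_{n:n}]}\,R_{\mathsf{Opt}_{\mathcal D}}(\mathcal D,\boldsymbol\sigma^*).$$ 2. If $\mathcal D$ is an exponential distribution (of any rate), then for every $n\ge n_0$ there is a vector $\boldsymbol\sigma^*$ that satisfies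 the MHR small-noise condition with $c=1/5626$ and such that, for every $\gamma$, $$R_{\mathsf{Opt}_{\mathcal D}}(\mathcal D,\boldsymbol\sigma^*)\ge\kappa\,\ln(n)\,R_{\mathsf{Linear}_\gamma}(\mathcal D,\boldsymbol\sigma^*).$$ -/

import Mathlib

namespace NoisyBoxes

open MeasureTheory ProbabilityTheory

/-- The distribution `D` is supported on `[0, ∞)`, has a density `f`, and has a monotone hazard
rate: with `F` the cumulative distribution function, the function `(1 - F) / f` is non-increasing.
Here `D (Set.Ioi x)` is `1 - F x`, and the quotient is taken in `[0, ∞]`, so that it is `∞` where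
`f` vanishes before the right end of the support, and `0` beyond that end. -/
structure IsMHR (D : Measure ℝ) : Prop where
  support_nonneg : D (Set.Iio 0) = 0
  exists_density : ∃ f : ℝ → ENNReal, Measurable f ∧ D = volume.withDensity f ∧
    Antitone (fun x : ℝ => D (Set.Ioi x) / f x)

/-- The mean `E[D]`. -/
noncomputable def mean (D : Measure ℝ) : ℝ := ∫ x, x ∂D

/-- `E[D_{m:m}]`, the expected maximum of `m` independent draws from `D`. -/
noncomputable def expectedMax (D : Measure ℝ) (m : ℕ) : ℝ :=
  ∫ x, (⨆ i, x i) ∂(Measure.pi fun _ : Fin m => D)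

/-- The small noise condition for MHR distributions: `σ` is a sorted vector of non-negative
standard deviations with `σ_{n^c} ≤ E[D_{n^c:n^c}] / (18 √(2 c ln n))`. When `n^c` is not an
integer it is rounded up on the left (at least `n^c` entries are small) and down on the right;
this is the most demanding way of rounding. Entry number `k` of `σ` is the one
with index `k - 1` in `Fin n`. -/
noncomputable def smallNoiseMHR (D : Measure ℝ) (n : ℕ) (c : ℝ) : Set (Fin n → ℝ) :=
  {σ | (∀ i, 0 ≤ σ i) ∧ Monotone σ ∧
    ∃ i : Fin n, (i : ℕ) + 1 = ⌈(n : ℝ) ^ c⌉₊ ∧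
      σ i ≤ expectedMax D ⌊(n : ℝ) ^ c⌋₊ / (18 * Real.sqrt (2 * c * Real.log n))}

/-- Joint law of the rewards `x` (independent draws from `D`) and of the noises `ε`
(independent of each other and of `x`, with `ε i` normal of mean `0` and standard
deviation `σ i`). -/
noncomputable def law (D : Measure ℝ) {n : ℕ} (σ : Fin n → ℝ) :
    Measure ((Fin n → ℝ) × (Fin n → ℝ)) :=
  (Measure.pi fun _ : Fin n => D).prod
    (Measure.pi fun i : Fin n => gaussianReal 0 (Real.toNNReal (σ i ^ 2)))

/-- The reward `X_i` of box `i`. -/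
def X {n : ℕ} (i : Fin n) (ω : (Fin n → ℝ) × (Fin n → ℝ)) : ℝ := ω.1 i

/-- The observation `Y_i = X_i + ε_i` of box `i`. -/
def Y {n : ℕ} (i : Fin n) (ω : (Fin n → ℝ) × (Fin n → ℝ)) : ℝ := ω.1 i + ω.2 i

/-- A policy maps the public information `(σ, y)` to a probability distribution over boxes. -/
structure Policy (n : ℕ) where
  prob : (Fin n → ℝ) → (Fin n → ℝ) → Fin n → ℝ
  prob_nonneg : ∀ σ y i, 0 ≤ prob σ y i
  prob_sum : ∀ σ y, ∑ i, prob σ y i = 1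
  measurable_prob : ∀ σ i, Measurable fun y => prob σ y i

/-- `A` is a linear policy with parameter `γ`: it only selects boxes `i` that maximize
`y_i - γ(σ, y) σ_i`. Ties may be broken in any way, also at random. -/
def Policy.IsLinear {n : ℕ} (A : Policy n) (γ : (Fin n → ℝ) → (Fin n → ℝ) → ℝ) : Prop :=
  ∀ σ y i, A.prob σ y i ≠ 0 → ∀ j, y j - γ σ y * σ j ≤ y i - γ σ y * σ i

/-- `R_A(D, σ)`, the expected reward of the policy `A`. -/
noncomputable def reward (D : Measure ℝ) {n : ℕ} (σ : Fin n → ℝ) (A : Policy n) : ℝ :=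
  ∫ ω, ∑ i, A.prob σ (fun j => Y j ω) i * X i ω ∂(law D σ)

/-- The expected reward `E[max_i E[X_i | Y_i]]` of the optimal policy that knows `D`. -/
noncomputable def optReward (D : Measure ℝ) {n : ℕ} (σ : Fin n → ℝ) : ℝ :=
  ∫ ω, (⨆ i : Fin n, ((law D σ)[X i | MeasurableSpace.comap (Y i) inferInstance]) ω) ∂(law D σ)

end NoisyBoxes

/-! Let `μ` be the mean, `c = 1/5626`, `m = ⌊n^c⌋`, `M = ⌈n^c⌉`, `E = E[D_{m:m}]` and `w = √(2c ln
n)`. In the hard instance one box has no noise, the next `M - 1` boxes have standard deviation `s =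
E/(18w)`, the largest value allowed, and all others have the huge standard deviation `S = nμ + s`.

A linear policy earns only `O(μ)` there (`reward_hardSD_le`). The noiseless box is worth `μ`. Among
the big boxes the policy takes one whose noise is within its own reward of the largest noise. Either
it has the largest noise, which is independent of the rewards, or there is a near tie, which is rare
since `S ≥ nμ`. To take a small box `i`, the policy must prefer it both to the noiseless box and to
every big box `j`. Eliminating `γ` from these two inequalities leaves `s ε_j ≤ S y_i`. This is
pointwise, so the dependence of `γ` on `y` does not help. Some big noise exceeds `S` times a
multiple of `√(ln n)`, which forces `y_i ≥ 3.3 E`. Some small box reaches this level with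
probability only `O(1/m)`.

The optimal policy does at least as well as the rule that takes the first small box with observation
at least `E/2`, and this rule earns at least `E/50` (`expectedMax_le_optReward_hardSD`). Since `n`
is at most a fixed power of `m`, `E[D_{n:n}]` is at most a constant times `E`
(`IsNBU.expectedMax_le_of_le_pow`).

The only property of `D` used is that its tail is submultiplicative, a consequence of MHR
(`IsMHR.isNBU`). It bounds the second moment by `8μ²` and controls the expected maxima. -/

namespace NoisyBoxes

open MeasureTheory ProbabilityTheory Set Filter Topology

/-! ### Tails and moments of new-better-than-used distributions -/

/-- A distribution on `(0, ∞)` is new better than used if its survival function is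
submultiplicative. -/
structure IsNBU (D : Measure ℝ) : Prop where
  measure_Iic_zero : D (Iic 0) = 0
  tail_add_le : ∀ x y : ℝ, 0 ≤ x → 0 ≤ y →
    D.real (Ioi (x + y)) ≤ D.real (Ioi x) * D.real (Ioi y)

lemma antitone_tail (D : Measure ℝ) [IsFiniteMeasure D] :
    Antitone fun x : ℝ => D.real (Ioi x) :=
  fun _ _ h => measureReal_mono (Ioi_subset_Ioi h)

namespace IsNBU

variable {D : Measure ℝ} [IsProbabilityMeasure D]

lemma ae_pos {D : Measure ℝ} (h : IsNBU D) : ∀ᵐ x ∂D, 0 < x := by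
  rw [ae_iff]
  simpa [Iic, not_lt] using h.measure_Iic_zero

lemma ae_nonneg {D : Measure ℝ} (h : IsNBU D) : ∀ᵐ x ∂D, 0 ≤ x := h.ae_pos.mono fun _ => le_of_lt

lemma tail_nat_mul_le (h : IsNBU D) {x : ℝ} (hx : 0 ≤ x) (k : ℕ) :
    D.real (Ioi (k * x)) ≤ D.real (Ioi x) ^ k := by
  induction k with
  | zero => simp
  | succ k ih =>
    have := h.tail_add_le (k * x) x (by positivity) hx
    rw [pow_succ]
    push_cast
    rw [add_mul, one_mul]
    exact this.trans (mul_le_mul_of_nonneg_right ih measureReal_nonneg)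

lemma exists_tail_le_half (_h : IsNBU D) : ∃ t : ℝ, 0 < t ∧ D.real (Ioi t) ≤ 1 / 2 := by
  have h1 := (tendsto_cdf_atTop D).eventually (lt_mem_nhds (show (1 / 2 : ℝ) < 1 by norm_num))
  obtain ⟨t, ht, ht0⟩ := (h1.and (eventually_gt_atTop 0)).exists
  refine ⟨t, ht0, ?_⟩
  rw [cdf_eq_real] at ht
  have := measureReal_compl (μ := D) (measurableSet_Iic (a := t))
  rw [compl_Iic] at this
  simp at this
  linarith

lemma exists_tail_le_exp (h : IsNBU D) :
    ∃ a : ℝ, 0 < a ∧ ∀ x, 0 ≤ x → D.real (Ioi x) ≤ 2 * Real.exp (-a * x) := by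
  obtain ⟨t, ht, hh⟩ := h.exists_tail_le_half
  refine ⟨Real.log 2 / t, by positivity, fun x hx => ?_⟩
  have h1 : (⌊x / t⌋₊ : ℝ) * t ≤ x := by
    rw [← le_div_iff₀ ht]; exact Nat.floor_le (by positivity)
  have h2 : x / t < ⌊x / t⌋₊ + 1 := Nat.lt_floor_add_one _
  calc D.real (Ioi x) ≤ D.real (Ioi (⌊x / t⌋₊ * t)) := antitone_tail D h1
    _ ≤ D.real (Ioi t) ^ ⌊x / t⌋₊ := h.tail_nat_mul_le ht.le _
    _ ≤ (1 / 2) ^ ⌊x / t⌋₊ := pow_le_pow_left₀ measureReal_nonneg hh _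
    _ = 2 * Real.exp (-(Real.log 2 * (⌊x / t⌋₊ + 1))) := by
      rw [Real.exp_neg, mul_add, mul_one, Real.exp_add, Real.exp_log (by norm_num),
        mul_comm (Real.log 2), ← Real.rpow_natCast, ← Real.log_rpow (by norm_num),
        Real.exp_log (by positivity), Real.rpow_natCast, one_div, inv_pow]
      field_simp
      exact Real.rpow_natCast _ _
    _ ≤ 2 * Real.exp (-(Real.log 2 / t) * x) := by
      gcongr
      have := mul_le_mul_of_nonneg_left h2.le (Real.log_nonneg (show (1 : ℝ) ≤ 2 by norm_num))
      calc _ ≤ -(Real.log 2 * (x / t)) := neg_le_neg this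
        _ = _ := by ring

lemma integrableOn_tail (h : IsNBU D) : IntegrableOn (fun t => D.real (Ioi t)) (Ioi 0) := by
  obtain ⟨a, ha, hle⟩ := h.exists_tail_le_exp
  refine ((exp_neg_integrableOn_Ioi 0 ha).const_mul 2).mono'
    (antitone_tail D).measurable.aestronglyMeasurable ?_
  filter_upwards [ae_restrict_mem measurableSet_Ioi] with x hx
  rw [Real.norm_of_nonneg measureReal_nonneg]
  exact hle x (le_of_lt hx)

lemma integrable_id (h : IsNBU D) : Integrable (fun x : ℝ => x) D := by
  refine ⟨by fun_prop, ?_⟩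
  rw [hasFiniteIntegral_iff_ofReal h.ae_nonneg,
    lintegral_eq_lintegral_meas_lt D h.ae_nonneg (by fun_prop)]
  have := h.integrableOn_tail.lintegral_lt_top
  refine lt_of_le_of_lt (le_of_eq (lintegral_congr fun t => ?_)) this
  rw [ofReal_measureReal]; rfl

lemma mean_eq (h : IsNBU D) : mean D = ∫ t in Ioi 0, D.real (Ioi t) :=
  h.integrable_id.integral_eq_integral_meas_lt h.ae_nonneg

lemma mean_pos (h : IsNBU D) : 0 < mean D := by
  unfold mean
  rw [integral_pos_iff_support_of_nonneg_ae h.ae_nonneg h.integrable_id]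
  refine pos_iff_ne_zero.2 fun h0 => ?_
  have : ∀ᵐ x ∂D, False := by
    filter_upwards [h.ae_pos, measure_eq_zero_iff_ae_notMem.1 h0] with x hx hx'
    exact hx' hx.ne'
  simp at this
  exact IsProbabilityMeasure.ne_zero D this

lemma integrable_excess (h : IsNBU D) (θ : ℝ) : Integrable (fun x : ℝ => max (x - θ) 0) D :=
  (h.integrable_id.sub (integrable_const θ)).sup (integrable_const 0)

/-- The excess has tail `t ↦ P(X > θ + t)`, which is at most `P(X > θ) P(X > t)`; integrating over
`t` gives the mean. -/
lemma integral_excess_le (h : IsNBU D) {θ : ℝ} (hθ : 0 ≤ θ) :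
    ∫ x, max (x - θ) 0 ∂D ≤ D.real (Ioi θ) * mean D := by
  rw [(h.integrable_excess θ).integral_eq_integral_meas_lt
    (Eventually.of_forall fun x => le_max_right _ _), h.mean_eq, ← integral_const_mul]
  refine integral_mono_of_nonneg (Eventually.of_forall fun x => measureReal_nonneg)
    (h.integrableOn_tail.const_mul _) ?_
  filter_upwards [ae_restrict_mem measurableSet_Ioi] with t (ht : 0 < t)
  refine le_trans (le_of_eq ?_) (h.tail_add_le θ t hθ ht.le)
  congr 1
  ext x
  simp only [mem_ofPred_eq, mem_Ioi, lt_max_iff, not_lt.2 ht.le, or_false]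
  constructor <;> intro _ <;> linarith

lemma mul_tail_le (h : IsNBU D) (t : ℝ) : t * D.real (Ioi t) ≤ mean D := by
  rcases le_total t 0 with ht | ht
  · exact (mul_nonpos_of_nonpos_of_nonneg ht measureReal_nonneg).trans h.mean_pos.le
  refine le_trans ?_ (mul_meas_ge_le_integral_of_nonneg h.ae_nonneg h.integrable_id t)
  exact mul_le_mul_of_nonneg_left (measureReal_mono fun x (hx : t < x) => hx.le) ht

/-- The second moment is `∫ 2t P(X > t) dt`. Splitting `t` into two halves gives `P(X > t) ≤ P(X >
t/2)²`, and Markov's inequality absorbs the factor `t/2` together with one of the two tails. What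
remains is `4μ ∫ P(X > t/2) dt = 8μ²`. -/
lemma lintegral_sq_le (h : IsNBU D) :
    ∫⁻ x, ENNReal.ofReal (x ^ 2) ∂D ≤ ENNReal.ofReal (8 * mean D ^ 2) := by
  have key := lintegral_comp_eq_lintegral_meas_lt_mul (g := fun t => 2 * t) D (f := fun x => x)
    h.ae_nonneg (by fun_prop) (fun t _ => (by fun_prop : Continuous _).intervalIntegrable _ _)
    (by filter_upwards [ae_restrict_mem measurableSet_Ioi] with t (ht : 0 < t); positivity)
  have e : ∀ x : ℝ, ∫ t in (0 : ℝ)..x, 2 * t = x ^ 2 := fun x => by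
    rw [intervalIntegral.integral_const_mul, integral_id]; ring
  simp only [e] at key
  rw [key]
  have h2 : IntegrableOn (fun t => D.real (Ioi ((1 / 2) * t))) (Ioi 0) := by
    have := (integrableOn_Ioi_comp_mul_left_iff (fun t => D.real (Ioi t)) 0
      (show (0 : ℝ) < 1 / 2 by norm_num)).2
    rw [mul_zero] at this
    exact this h.integrableOn_tail
  have h3 : ∫ t in Ioi 0, D.real (Ioi ((1 / 2) * t)) = 2 * mean D := by
    have := integral_comp_mul_left_Ioi (fun t => D.real (Ioi t)) 0
      (show (0 : ℝ) < 1 / 2 by norm_num)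
    rw [mul_zero] at this
    rw [this, h.mean_eq]; simp
  calc _ ≤ ∫⁻ t in Ioi 0, ENNReal.ofReal (4 * mean D * D.real (Ioi ((1 / 2) * t))) := by
        refine setLIntegral_mono' measurableSet_Ioi fun t (ht : 0 < t) => ?_
        have : {a : ℝ | t < a} = Ioi t := rfl
        rw [this, ← ofReal_measureReal, ← ENNReal.ofReal_mul measureReal_nonneg]
        refine ENNReal.ofReal_le_ofReal ?_
        have a1 := h.tail_add_le ((1 / 2) * t) ((1 / 2) * t) (by positivity) (by positivity)
        rw [← add_mul, add_halves, one_mul] at a1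
        have a2 := h.mul_tail_le ((1 / 2) * t)
        have a3 : 0 ≤ D.real (Ioi ((1 / 2) * t)) := measureReal_nonneg
        nlinarith
    _ = ENNReal.ofReal (∫ t in Ioi 0, 4 * mean D * D.real (Ioi ((1 / 2) * t))) := by
        rw [ofReal_integral_eq_lintegral_ofReal (h2.const_mul _)]
        exact Eventually.of_forall fun t =>
          mul_nonneg (mul_nonneg (by norm_num) h.mean_pos.le) measureReal_nonneg
    _ ≤ _ := by
        refine ENNReal.ofReal_le_ofReal (le_of_eq ?_)
        rw [integral_const_mul, h3]; ring

lemma integrable_sq (h : IsNBU D) : Integrable (fun x : ℝ => x ^ 2) D := by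
  refine ⟨by fun_prop, ?_⟩
  rw [hasFiniteIntegral_iff_ofReal (Eventually.of_forall fun x => sq_nonneg x)]
  exact h.lintegral_sq_le.trans_lt ENNReal.ofReal_lt_top

lemma integral_sq_le (h : IsNBU D) : ∫ x, x ^ 2 ∂D ≤ 8 * mean D ^ 2 := by
  rw [integral_eq_lintegral_of_nonneg_ae (Eventually.of_forall fun x => sq_nonneg x)
    (by fun_prop)]
  exact ENNReal.toReal_le_of_le_ofReal (by positivity) h.lintegral_sq_le

end IsNBU

/-! ### Coordinates and suprema under product measures -/

lemma integral_pi_eval {ι : Type*} [Fintype ι] (μ : ι → Measure ℝ)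
    [∀ i, IsProbabilityMeasure (μ i)] (i : ι) {f : ℝ → ℝ} (hf : AEStronglyMeasurable f (μ i)) :
    ∫ x, f (x i) ∂(Measure.pi μ) = ∫ x, f x ∂(μ i) := by
  have hp := measurePreserving_eval μ i
  rw [← hp.map_eq, integral_map hp.measurable.aemeasurable (by rwa [hp.map_eq])]

lemma integrable_pi_eval {ι : Type*} [Fintype ι] (μ : ι → Measure ℝ)
    [∀ i, IsProbabilityMeasure (μ i)] (i : ι) {f : ℝ → ℝ} (hf : Integrable f (μ i)) :
    Integrable (fun x => f (x i)) (Measure.pi μ) :=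
  (measurePreserving_eval μ i).integrable_comp_of_integrable hf

lemma ae_pi_eval {ι : Type*} [Fintype ι] (μ : ι → Measure ℝ)
    [∀ i, IsProbabilityMeasure (μ i)] {p : ι → ℝ → Prop} (hp : ∀ i, ∀ᵐ x ∂(μ i), p i x) :
    ∀ᵐ x ∂(Measure.pi μ), ∀ i, p i (x i) :=
  ae_all_iff.2 fun i => (measurePreserving_eval μ i).quasiMeasurePreserving.ae (hp i)

lemma integrable_iSup {Ω ι : Type*} [MeasurableSpace Ω] {μ : Measure Ω} [Fintype ι] [Nonempty ι]
    {f : ι → Ω → ℝ} (hf : ∀ i, Integrable (f i) μ) : Integrable (fun ω => ⨆ i, f i ω) μ := by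
  have : (fun ω => ⨆ i, f i ω) = Finset.univ.sup' Finset.univ_nonempty f := by
    ext ω
    rw [Finset.sup'_apply, Finset.sup'_univ_eq_ciSup]
  rw [this]
  exact Finset.sup'_induction (p := fun g => Integrable g μ) _ _ (fun _ ha _ hb => ha.sup hb)
    fun i _ => hf i

/-! ### Expected maxima and quantiles -/

namespace IsNBU

variable {D : Measure ℝ} [IsProbabilityMeasure D]

lemma integrable_sup (h : IsNBU D) (m : ℕ) :
    Integrable (fun x : Fin m → ℝ => ⨆ i, x i) (Measure.pi fun _ : Fin m => D) := by
  rcases Nat.eq_zero_or_pos m with rfl | hm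
  · simp
  have : Nonempty (Fin m) := ⟨⟨0, hm⟩⟩
  exact integrable_iSup fun i => integrable_pi_eval (fun _ => D) i h.integrable_id

/-- The maximum is at most `θ` plus the sum of all excesses over `θ`. -/
lemma expectedMax_le (h : IsNBU D) {m : ℕ} (hm : 0 < m) {θ : ℝ} (hθ : 0 ≤ θ) :
    expectedMax D m ≤ θ + m * (D.real (Ioi θ) * mean D) := by
  have : Nonempty (Fin m) := ⟨⟨0, hm⟩⟩
  have hi : ∀ i : Fin m, Integrable (fun x : Fin m → ℝ => max (x i - θ) 0)
      (Measure.pi fun _ : Fin m => D) := fun i =>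
    integrable_pi_eval (fun _ => D) i (h.integrable_excess θ)
  calc expectedMax D m ≤ ∫ x, (θ + ∑ i, max (x i - θ) 0) ∂(Measure.pi fun _ : Fin m => D) := by
        refine integral_mono (h.integrable_sup m)
          ((integrable_const θ).add (integrable_finsetSum _ fun i _ => hi i)) fun x => ?_
        refine ciSup_le fun i => ?_
        have := Finset.single_le_sum (f := fun i => max (x i - θ) 0)
          (fun j _ => le_max_right _ _) (Finset.mem_univ i)
        linarith [le_max_left (x i - θ) 0]
    _ = θ + ∑ i : Fin m, ∫ x, max (x - θ) 0 ∂D := by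
        rw [integral_add (integrable_const θ) (integrable_finsetSum _ fun i _ => hi i),
          integral_finsetSum _ fun i _ => hi i]
        simp only [integral_const, probReal_univ, one_smul]
        congr 1
        exact Finset.sum_congr rfl fun i _ =>
          integral_pi_eval (fun _ => D) i (f := fun x => max (x - θ) 0) (by fun_prop)
    _ ≤ _ := by
        rw [Finset.sum_const, Finset.card_univ, Fintype.card_fin, nsmul_eq_mul]
        gcongr
        exact h.integral_excess_le hθ

/-- Markov's inequality for the maximum, which exceeds `θ` unless all `m` draws are at most `θ`. -/
lemma le_expectedMax (h : IsNBU D) {m : ℕ} (hm : 0 < m) (θ : ℝ) :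
    θ * (1 - (1 - D.real (Ioi θ)) ^ m) ≤ expectedMax D m := by
  have : Nonempty (Fin m) := ⟨⟨0, hm⟩⟩
  set P := Measure.pi fun _ : Fin m => D
  set A : Set (Fin m → ℝ) := Set.univ.pi fun _ => Iic θ
  have hA : MeasurableSet A := MeasurableSet.univ_pi fun _ => measurableSet_Iic
  have hPA : P.real A = (1 - D.real (Ioi θ)) ^ m := by
    have : D.real (Iic θ) = 1 - D.real (Ioi θ) := by
      rw [← compl_Ioi, probReal_compl_eq_one_sub measurableSet_Ioi]
    rw [← this, measureReal_def, Measure.pi_pi]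
    simp [measureReal_def]
  rw [← hPA, ← probReal_compl_eq_one_sub hA]
  have : θ * P.real Aᶜ = ∫ x, Aᶜ.indicator (fun _ => θ) x ∂P := by
    rw [integral_indicator_const _ hA.compl, smul_eq_mul, mul_comm]
  rw [this]
  refine integral_mono_ae ((integrable_const θ).indicator hA.compl) (h.integrable_sup m) ?_
  filter_upwards [ae_pi_eval (fun _ : Fin m => D) (p := fun _ x => 0 ≤ x) fun _ => h.ae_nonneg]
    with x hx
  have hb : BddAbove (range x) := (finite_range x).bddAbove
  by_cases hxA : x ∈ A
  · rw [indicator_of_notMem (by simpa using hxA)]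
    exact (hx ⟨0, hm⟩).trans (le_ciSup hb _)
  · rw [indicator_of_mem (by simpa using hxA)]
    simp only [A, Set.mem_pi, mem_univ, true_implies, mem_Iic, not_forall, not_le] at hxA
    obtain ⟨i, hi⟩ := hxA
    exact hi.le.trans (le_ciSup hb i)

lemma mean_le_expectedMax (h : IsNBU D) {m : ℕ} (hm : 0 < m) : mean D ≤ expectedMax D m := by
  have := integral_pi_eval (fun _ : Fin m => D) ⟨0, hm⟩ (f := fun x => x) (by fun_prop)
  rw [mean, ← this]
  refine integral_mono (integrable_pi_eval (fun _ => D) _ h.integrable_id) (h.integrable_sup m)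
    fun x => le_ciSup (finite_range x).bddAbove _

lemma expectedMax_pos (h : IsNBU D) {m : ℕ} (hm : 0 < m) : 0 < expectedMax D m :=
  h.mean_pos.trans_le (h.mean_le_expectedMax hm)

/-- With a tail above `1/m`, the maximum would exceed `8E/5` with probability at least `1 - 1/e >
5/8`, and its mean would then exceed `E`. -/
lemma tail_expectedMax_le (h : IsNBU D) {m : ℕ} (hm : 0 < m) :
    D.real (Ioi (8 / 5 * expectedMax D m)) ≤ 1 / m := by
  by_contra! hlt
  have hE := h.expectedMax_pos hm
  have h1 := h.le_expectedMax hm (8 / 5 * expectedMax D m)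
  have hm' : (0 : ℝ) < m := by exact_mod_cast hm
  set q := D.real (Ioi (8 / 5 * expectedMax D m))
  have h2 : (1 - q) ^ m ≤ Real.exp (-1) := by
    calc (1 - q) ^ m ≤ Real.exp (-q) ^ m := by
          refine pow_le_pow_left₀ (sub_nonneg.2 measureReal_le_one) ?_ _
          linarith [Real.add_one_le_exp (-q)]
      _ = Real.exp (-(m * q)) := by rw [← Real.exp_nat_mul]; ring_nf
      _ ≤ Real.exp (-1) := by
          gcongr
          rw [div_lt_iff₀ hm'] at hlt
          linarith
  have h3 : Real.exp (-1) < 3 / 8 := by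
    have := Real.exp_one_gt_d9
    rw [Real.exp_neg, inv_lt_comm₀ (Real.exp_pos _) (by norm_num)]
    norm_num at this ⊢
    linarith
  nlinarith

lemma tail_mul_expectedMax_le (h : IsNBU D) {m : ℕ} (hm : 0 < m) (k : ℕ) :
    D.real (Ioi (k * (8 / 5 * expectedMax D m))) ≤ (1 / m) ^ k := by
  have hE := h.expectedMax_pos hm
  exact (h.tail_nat_mul_le (by positivity) k).trans
    (pow_le_pow_left₀ measureReal_nonneg (h.tail_expectedMax_le hm) k)

/-- At the threshold `k · 8E/5` the tail is at most `m^(-k) ≤ 1/n`, so the excesses of `n` draws add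
at most one mean. -/
lemma expectedMax_le_of_le_pow (h : IsNBU D) {m n k : ℕ} (hm : 0 < m) (hn : 0 < n)
    (hnm : n ≤ m ^ k) : expectedMax D n ≤ (2 * k + 1) * expectedMax D m := by
  have hE := h.expectedMax_pos hm
  have hμ := h.mean_pos
  have h1 := h.expectedMax_le hn (θ := k * (8 / 5 * expectedMax D m)) (by positivity)
  have h2 := h.tail_mul_expectedMax_le hm k
  have h3 : (n : ℝ) * D.real (Ioi (k * (8 / 5 * expectedMax D m))) ≤ 1 := by
    calc (n : ℝ) * D.real (Ioi (k * (8 / 5 * expectedMax D m)))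
        ≤ (m : ℝ) ^ k * (1 / m) ^ k := by
          gcongr
          exact_mod_cast hnm
      _ = 1 := by
          have : (m : ℝ) ≠ 0 := by exact_mod_cast hm.ne'
          rw [← mul_pow, mul_one_div_cancel this, one_pow]
  have h4 := h.mean_le_expectedMax hm
  have h5 : (0 : ℝ) ≤ k * expectedMax D m := by positivity
  nlinarith

/-- Cutting at `E/2`, the excesses must supply the other half of `E`, and each supplies at most the
tail times `μ ≤ E`. -/
lemma le_tail_half_expectedMax (h : IsNBU D) {m : ℕ} (hm : 0 < m) :
    1 / 2 ≤ m * D.real (Ioi (expectedMax D m / 2)) := by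
  have hE := h.expectedMax_pos hm
  have h1 := h.expectedMax_le hm (θ := expectedMax D m / 2) (by positivity)
  have h4 := h.mean_le_expectedMax hm
  have : 0 ≤ m * D.real (Ioi (expectedMax D m / 2)) := by positivity
  by_contra! hc
  nlinarith

end IsNBU

/-! ### From monotone hazard rate to new better than used -/

lemma tail_sub_tail (D : Measure ℝ) [IsFiniteMeasure D] {a b : ℝ} (hab : a ≤ b) :
    D.real (Ioi a) - D.real (Ioi b) = D.real (Ioc a b) := by
  rw [← Ioc_union_Ioi_eq_Ioi hab, measureReal_union (Ioc_disjoint_Ioi le_rfl) measurableSet_Ioi]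
  ring

section Hazard

variable {D : Measure ℝ} [IsFiniteMeasure D] {f : ℝ → ENNReal} (hf : Measurable f)
  (hD : D = volume.withDensity f) {r : ENNReal}

include hf hD

lemma mul_tail_le_of_hazard_ge (hr : r ≠ ⊤) {a δ : ℝ} (hδ : 0 ≤ δ)
    (h : ∀ b, a < b → D (Ioi b) ≤ r * f b) :
    δ * D.real (Ioi (a + δ)) ≤ r.toReal * (D.real (Ioi a) - D.real (Ioi (a + δ))) := by
  rw [tail_sub_tail D (by linarith), measureReal_def, measureReal_def, ← ENNReal.toReal_mul,
    show δ * (D (Ioi (a + δ))).toReal = (ENNReal.ofReal δ * D (Ioi (a + δ))).toReal by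
      rw [ENNReal.toReal_mul, ENNReal.toReal_ofReal hδ]]
  refine ENNReal.toReal_mono (ENNReal.mul_ne_top hr (measure_ne_top _ _)) ?_
  calc ENNReal.ofReal δ * D (Ioi (a + δ)) = ∫⁻ _ in Ioc a (a + δ), D (Ioi (a + δ)) := by
        rw [setLIntegral_const, Real.volume_Ioc, mul_comm]; simp
    _ ≤ ∫⁻ b in Ioc a (a + δ), r * f b := setLIntegral_mono' measurableSet_Ioc fun b hb =>
        (measure_mono (Ioi_subset_Ioi hb.2)).trans (h b hb.1)
    _ = r * D (Ioc a (a + δ)) := by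
        rw [lintegral_const_mul _ hf]
        conv_rhs => rw [hD, withDensity_apply _ measurableSet_Ioc]

lemma mul_tail_sub_le_of_hazard_le {a δ : ℝ} (hδ : 0 ≤ δ)
    (h : ∀ b, b ≤ a + δ → r * f b ≤ D (Ioi b)) :
    r.toReal * (D.real (Ioi a) - D.real (Ioi (a + δ))) ≤ δ * D.real (Ioi a) := by
  rw [tail_sub_tail D (by linarith), measureReal_def, measureReal_def, ← ENNReal.toReal_mul]
  conv_rhs => rw [← ENNReal.toReal_ofReal hδ]
  rw [← ENNReal.toReal_mul]
  refine ENNReal.toReal_mono (ENNReal.mul_ne_top ENNReal.ofReal_ne_top (measure_ne_top _ _)) ?_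
  calc r * D (Ioc a (a + δ)) = ∫⁻ b in Ioc a (a + δ), r * f b := by
        rw [lintegral_const_mul _ hf]
        conv_lhs => rw [hD, withDensity_apply _ measurableSet_Ioc]
    _ ≤ ∫⁻ _ in Ioc a (a + δ), D (Ioi a) := setLIntegral_mono' measurableSet_Ioc fun b hb =>
        (h b hb.2).trans (measure_mono (Ioi_subset_Ioi hb.1.le))
    _ = ENNReal.ofReal δ * D (Ioi a) := by
        rw [setLIntegral_const, Real.volume_Ioc, mul_comm]; simp

/-- A hazard rate of at least `1/r` beyond `x` makes the tail decay at least like `exp(-y/r)`. The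
density need not be continuous, so the tail is not differentiated: `[x, x + y]` is cut into `N`
steps, each gaining a factor `1 + y/(rN)`, and `N` tends to infinity. -/
lemma tail_mul_exp_le (hr : r ≠ ⊤) (hr0 : r ≠ 0) {x y : ℝ} (hy : 0 ≤ y)
    (h : ∀ b, x < b → D (Ioi b) ≤ r * f b) :
    D.real (Ioi (x + y)) * Real.exp (y / r.toReal) ≤ D.real (Ioi x) := by
  have hr' : 0 < r.toReal := ENNReal.toReal_pos hr0 hr
  have lim := (Real.tendsto_one_add_div_pow_exp (y / r.toReal)).const_mul (D.real (Ioi (x + y)))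
  refine le_of_tendsto lim ?_
  filter_upwards [eventually_gt_atTop 0] with N hN
  have hN' : (0 : ℝ) < N := by exact_mod_cast hN
  have step : ∀ k : ℕ, D.real (Ioi (x + k * (y / N))) * (1 + y / r.toReal / N) ^ k
      ≤ D.real (Ioi x) := by
    intro k
    induction k with
    | zero => simp
    | succ k ih =>
      refine le_trans ?_ ih
      have hδ : 0 ≤ y / N := by positivity
      have h1 := mul_tail_le_of_hazard_ge hf hD hr (a := x + k * (y / N)) hδ
        fun b hb => h b (lt_of_le_of_lt (by nlinarith [k.cast_nonneg (α := ℝ)]) hb)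
      have e : x + k * (y / N) + y / N = x + (k + 1 : ℕ) * (y / N) := by push_cast; ring
      rw [e] at h1
      rw [pow_succ', ← mul_assoc]
      refine mul_le_mul_of_nonneg_right ?_ (by positivity)
      have e2 : y / r.toReal / N = y / N / r.toReal := by ring
      rw [e2, mul_add, mul_one, ← mul_div_assoc (D.real _) (y / N) r.toReal, ← le_sub_iff_add_le', div_le_iff₀ hr']
      linarith
  have := step N
  rwa [mul_div_cancel₀ _ hN'.ne'] at this

/-- The mirror image: a hazard rate of at most `1/r` up to `y` costs a factor of at least `1 -
y/(rN)` per step. -/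
lemma tail_ge_exp (hr : r ≠ ⊤) (hr0 : r ≠ 0) {y : ℝ} (hy : 0 ≤ y) (h0 : D.real (Ioi 0) = 1)
    (h : ∀ b, b ≤ y → r * f b ≤ D (Ioi b)) :
    Real.exp (-(y / r.toReal)) ≤ D.real (Ioi y) := by
  have hr' : 0 < r.toReal := ENNReal.toReal_pos hr0 hr
  have lim := Real.tendsto_one_add_div_pow_exp (-(y / r.toReal))
  refine le_of_tendsto lim ?_
  filter_upwards [eventually_gt_atTop 0, eventually_ge_atTop ⌈y / r.toReal⌉₊] with N hN hN2
  have hN' : (0 : ℝ) < N := by exact_mod_cast hN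
  have hN3 : y / r.toReal / N ≤ 1 := by
    rw [div_le_one hN']
    exact (Nat.le_ceil _).trans (by exact_mod_cast hN2)
  have step : ∀ k : ℕ, k ≤ N → (1 + -(y / r.toReal) / N) ^ k ≤ D.real (Ioi (k * (y / N))) := by
    intro k
    induction k with
    | zero => simp [h0]
    | succ k ih =>
      intro hk
      have ih := ih (by omega)
      have hδ : 0 ≤ y / N := by positivity
      have e : k * (y / N) + y / N = (k + 1 : ℕ) * (y / N) := by push_cast; ring
      have h1 := mul_tail_sub_le_of_hazard_le hf hD (a := k * (y / N)) hδ
        fun b hb => h b (hb.trans (by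
          rw [e]
          calc ((k + 1 : ℕ) : ℝ) * (y / N) ≤ N * (y / N) := by gcongr
            _ = y := mul_div_cancel₀ _ hN'.ne'))
      rw [e] at h1
      have h2 : 0 ≤ 1 + -(y / r.toReal) / N := by rw [neg_div]; linarith
      rw [pow_succ]
      refine (mul_le_mul_of_nonneg_right ih h2).trans ?_
      have e2 : -(y / r.toReal) / N = -(y / N / r.toReal) := by ring
      rw [e2, mul_add, mul_one, mul_neg, ← mul_div_assoc (D.real _) (y / N) r.toReal, ← sub_eq_add_neg, sub_le_comm,
        le_div_iff₀ hr']
      linarith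
  have := step N le_rfl
  rwa [mul_div_cancel₀ _ hN'.ne'] at this

end Hazard

/-- For `y ≤ x`, compare both tails with the exponential whose hazard rate is that of `D` at `x`.
Beyond `x` the hazard is larger, so `P(X > x + y) ≤ P(X > x) exp(-y/r)`; before `x` it is smaller,
so `exp(-y/r) ≤ P(X > y)`. -/
lemma IsMHR.isNBU {D : Measure ℝ} [IsProbabilityMeasure D] (h : IsMHR D) : IsNBU D := by
  obtain ⟨f, hf, hD, hanti⟩ := h.exists_density
  have h0 : D (Iic 0) = 0 := by
    have : D {0} = 0 := by
      rw [hD]; exact withDensity_absolutelyContinuous _ _ Real.volume_singleton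
    rw [← Iio_union_right]
    exact measure_union_null h.support_nonneg this
  have h1 : D.real (Ioi 0) = 1 := by
    rw [← compl_Iic, probReal_compl_eq_one_sub measurableSet_Iic, measureReal_def, h0]; simp
  have main : ∀ x y : ℝ, 0 ≤ y → y ≤ x →
      D.real (Ioi (x + y)) ≤ D.real (Ioi x) * D.real (Ioi y) := by
    intro x y hy hyx
    rcases hy.eq_or_lt with rfl | hy0
    · simp [h1]
    rcases eq_or_ne (D (Ioi x)) 0 with hx | hx
    · have : D.real (Ioi (x + y)) ≤ D.real (Ioi x) := antitone_tail D (by linarith)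
      have hx' : D.real (Ioi x) = 0 := by rw [measureReal_def, hx]; rfl
      rw [hx'] at this ⊢
      linarith
    -- Here the quotient at `x` is infinite, hence infinite at all earlier points: there is no mass
    -- up to `x`, and `P(X > y) = 1`.
    rcases eq_or_ne (f x) 0 with hfx | hfx
    · have hb : ∀ b, b ≤ x → f b = 0 := by
        intro b hb
        have := hanti hb
        simp only [hfx, ENNReal.div_zero hx, top_le_iff] at this
        by_contra hne
        exact (ENNReal.div_lt_top (measure_ne_top _ _) hne).ne this
      have hz : D.real (Ioc 0 y) = 0 := by
        have : D (Ioc 0 y) = 0 := by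
          rw [hD, withDensity_apply _ measurableSet_Ioc,
            setLIntegral_congr_fun measurableSet_Ioc
              (fun b hb' => hb b (hb'.2.trans hyx) : EqOn f (fun _ => 0) _)]
          simp
        rw [measureReal_def, this]; rfl
      rw [← tail_sub_tail D hy, h1, sub_eq_zero] at hz
      rw [← hz, mul_one]
      exact antitone_tail D (by linarith)
    -- Here the quotient vanishes from `x` on. As `f` is finite almost everywhere, the tail is
    -- already zero at some point before `x + y`.
    rcases eq_or_ne (f x) ⊤ with hfx' | hfx'
    · have hb : ∀ b, x ≤ b → D (Ioi b) = 0 ∨ f b = ⊤ := by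
        intro b hb
        have := hanti hb
        simpa [hfx', ENNReal.div_eq_zero_iff] using this
      have hlt : ∀ᵐ b, f b < ⊤ := by
        refine ae_lt_top hf ?_
        have : ∫⁻ b, f b = D univ := by rw [hD, withDensity_apply _ MeasurableSet.univ]; simp
        rw [this]; simp
      have hpos : volume (Ioo x (x + y)) ≠ 0 := by simp [hy0]
      obtain ⟨b, hbI, hbf⟩ : ∃ b ∈ Ioo x (x + y), f b < ⊤ := by
        by_contra! hc
        exact hpos (measure_mono_null (fun b hb => not_lt.2 (hc b hb)) (ae_iff.1 hlt))
      have hb0 := (hb b hbI.1.le).resolve_right hbf.ne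
      have : D.real (Ioi (x + y)) ≤ D.real (Ioi b) := antitone_tail D hbI.2.le
      rw [measureReal_def D (Ioi b), hb0] at this
      exact this.trans (by simp only [ENNReal.toReal_zero]; positivity)
    set r := D (Ioi x) / f x with hr
    have hr0 : r ≠ 0 := ENNReal.div_ne_zero.2 ⟨hx, hfx'⟩
    have hrt : r ≠ ⊤ := (ENNReal.div_lt_top (measure_ne_top _ _) hfx).ne
    have hA := tail_mul_exp_le hf hD hrt hr0 hy (x := x) fun b hb => by
      have := hanti hb.le
      exact (ENNReal.div_le_iff_le_mul (Or.inr hrt) (Or.inr hr0)).1 this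
    have hB := tail_ge_exp hf hD hrt hr0 hy h1 fun b hb => by
      have hbx := hb.trans hyx
      have := hanti hbx
      have hne : D (Ioi b) ≠ 0 := fun h => hx (measure_mono_null (Ioi_subset_Ioi hbx) h)
      exact (ENNReal.le_div_iff_mul_le (Or.inr hne) (Or.inr (measure_ne_top _ _))).1 this
    calc D.real (Ioi (x + y))
        = D.real (Ioi (x + y)) * Real.exp (y / r.toReal) * Real.exp (-(y / r.toReal)) := by
          rw [mul_assoc, ← Real.exp_add]; simp
      _ ≤ _ := mul_le_mul hA hB (Real.exp_pos _).le measureReal_nonneg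
  refine ⟨h0, fun x y hx hy => ?_⟩
  rcases le_total y x with hyx | hyx
  · exact main x y hy hyx
  · rw [add_comm, mul_comm]; exact main y x hx hyx

/-! ### The exponential distribution -/

lemma tail_expMeasure {r : ℝ} (hr : 0 < r) {x : ℝ} (hx : 0 ≤ x) :
    (expMeasure r).real (Ioi x) = Real.exp (-(r * x)) := by
  have := isProbabilityMeasure_expMeasure hr
  have h := cdf_expMeasure_eq hr x
  rw [cdf_eq_real, if_pos hx] at h
  rw [← compl_Iic, probReal_compl_eq_one_sub measurableSet_Iic, h]
  ring

lemma isMHR_expMeasure {r : ℝ} (hr : 0 < r) : IsMHR (expMeasure r) := by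
  have := isProbabilityMeasure_expMeasure hr
  have hD : expMeasure r = volume.withDensity (exponentialPDF r) := rfl
  refine ⟨?_, exponentialPDF r, (measurable_exponentialPDFReal r).ennreal_ofReal, hD, ?_⟩
  · rw [hD, withDensity_apply _ measurableSet_Iio]
    exact lintegral_exponentialPDF_of_nonpos le_rfl
  · have hpos : ∀ x, 0 ≤ x →
        expMeasure r (Ioi x) / exponentialPDF r x = (ENNReal.ofReal r)⁻¹ := by
      intro x hx
      have he : ENNReal.ofReal (Real.exp (-(r * x))) ≠ 0 := by simp [Real.exp_pos]
      rw [exponentialPDF_of_nonneg hx, ← ofReal_measureReal, tail_expMeasure hr hx,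
        ENNReal.ofReal_mul hr.le, ENNReal.div_eq_inv_mul,
        ENNReal.mul_inv (Or.inr ENNReal.ofReal_ne_top) (Or.inr he), mul_assoc,
        ENNReal.inv_mul_cancel he ENNReal.ofReal_ne_top, mul_one]
    -- The quotient is constant on `[0, ∞)` and equals `∞` on the negative axis, where the density
    -- vanishes.
    intro a b hab
    rcases le_or_gt 0 a with ha | ha
    · simp only [hpos a ha, hpos b (ha.trans hab), le_refl]
    · have : expMeasure r (Ioi a) ≠ 0 := by
        intro h0
        have h1 := tail_expMeasure hr le_rfl
        rw [measureReal_def, measure_mono_null (Ioi_subset_Ioi ha.le) h0] at h1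
        simp at h1
      simp [exponentialPDF_of_neg ha, ENNReal.div_zero this]

lemma mean_expMeasure {r : ℝ} (hr : 0 < r) : mean (expMeasure r) = 1 / r := by
  have := isProbabilityMeasure_expMeasure hr
  rw [(isMHR_expMeasure hr).isNBU.mean_eq,
    setIntegral_congr_fun measurableSet_Ioi fun t (ht : 0 < t) => tail_expMeasure hr ht.le]
  have := integral_exp_mul_Ioi (a := -r) (by linarith) 0
  simpa [neg_mul] using this

lemma le_expectedMax_expMeasure {r : ℝ} (hr : 0 < r) {n : ℕ} (hn : 0 < n) :
    Real.log n / (2 * r) ≤ expectedMax (expMeasure r) n := by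
  have := isProbabilityMeasure_expMeasure hr
  have hn' : (1 : ℝ) ≤ n := by exact_mod_cast hn
  have hl := Real.log_nonneg hn'
  have h1 := (isMHR_expMeasure hr).isNBU.le_expectedMax hn (Real.log n / r)
  refine le_trans ?_ h1
  rw [tail_expMeasure hr (by positivity), mul_div_cancel₀ _ hr.ne', Real.exp_neg,
    Real.exp_log (by linarith)]
  have h2 : (1 - (n : ℝ)⁻¹) ^ n ≤ Real.exp (-1) := by
    calc (1 - (n : ℝ)⁻¹) ^ n ≤ Real.exp (-(n : ℝ)⁻¹) ^ n := by
          refine pow_le_pow_left₀ (sub_nonneg.2 (inv_le_one_of_one_le₀ hn')) ?_ _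
          linarith [Real.add_one_le_exp (-(n : ℝ)⁻¹)]
      _ = Real.exp (-1) := by
          rw [← Real.exp_nat_mul, mul_neg, mul_inv_cancel₀ (by linarith)]
  have h3 : Real.exp (-1) < 1 / 2 := by
    have := Real.exp_one_gt_d9
    rw [Real.exp_neg, inv_lt_comm₀ (Real.exp_pos _) (by norm_num)]
    norm_num at this ⊢
    linarith
  have h4 : 0 ≤ Real.log n / r := by positivity
  have e : Real.log n / (2 * r) = Real.log n / r * (1 / 2) := by field_simp
  rw [e]
  gcongr
  linarith

/-! ### Gaussian tails and densities -/

section Gaussian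

lemma hasSubgaussianMGF_id_gaussianReal (v : NNReal) :
    HasSubgaussianMGF id v (gaussianReal 0 v) where
  integrable_exp_mul t := integrable_exp_mul_gaussianReal t
  mgf_le t := by rw [mgf_id_gaussianReal]; simp

lemma gaussianReal_Ici_le {σ a : ℝ} (ha : 0 ≤ a) :
    (gaussianReal 0 (Real.toNNReal (σ ^ 2))).real (Ici a) ≤ Real.exp (-a ^ 2 / (2 * σ ^ 2)) := by
  have := (hasSubgaussianMGF_id_gaussianReal (Real.toNNReal (σ ^ 2))).measure_ge_le ha
  rwa [Real.coe_toNNReal _ (sq_nonneg σ)] at this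

lemma half_le_gaussianReal_Ici_zero (v : NNReal) : 1 / 2 ≤ (gaussianReal 0 v).real (Ici 0) := by
  have h1 : (gaussianReal 0 v).real (Iic 0) = (gaussianReal 0 v).real (Ici 0) := by
    conv_lhs => rw [← neg_zero (G := ℝ), ← gaussianReal_map_neg]
    rw [neg_zero, map_measureReal_apply measurable_neg measurableSet_Iic]
    congr 1
    ext x
    simp
  have h2 := measureReal_union_le (μ := gaussianReal 0 v) (Iic 0) (Ici 0)
  rw [Iic_union_Ici, probReal_univ, h1] at h2
  linarith

lemma gaussianPDF_le_inv {σ : ℝ} (hσ : 0 < σ) (x : ℝ) :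
    gaussianPDF 0 (Real.toNNReal (σ ^ 2)) x ≤ ENNReal.ofReal (1 / σ) := by
  rw [gaussianPDF]
  refine ENNReal.ofReal_le_ofReal ?_
  rw [gaussianPDFReal, Real.coe_toNNReal _ (sq_nonneg σ), one_div]
  refine (mul_le_of_le_one_right (by positivity) (Real.exp_le_one_iff.2 ?_)).trans ?_
  · rw [neg_div]; exact neg_nonpos.2 (by positivity)
  · refine inv_anti₀ hσ (Real.le_sqrt_of_sq_le ?_)
    nlinarith [Real.pi_gt_three, sq_nonneg σ]

lemma gaussianReal_Icc_le {σ : ℝ} (hσ : 0 < σ) (a b : ℝ) :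
    gaussianReal 0 (Real.toNNReal (σ ^ 2)) (Icc a b) ≤ ENNReal.ofReal ((b - a) / σ) := by
  rw [gaussianReal_apply 0 (by positivity : Real.toNNReal (σ ^ 2) ≠ 0)]
  calc _ ≤ ∫⁻ _ in Icc a b, ENNReal.ofReal (1 / σ) := lintegral_mono fun x => gaussianPDF_le_inv hσ x
    _ = ENNReal.ofReal ((b - a) / σ) := by
      rw [setLIntegral_const, Real.volume_Icc, ← ENNReal.ofReal_mul (by positivity)]
      congr 1; ring

/-- Only the interval from `σu` to `σ(u + 1)` is kept, where the density is smallest at the right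
end; `√(2π) ≤ 3`. -/
lemma le_gaussianReal_Ici {σ u : ℝ} (hσ : 0 < σ) (hu : 0 ≤ u) :
    Real.exp (-(u + 1) ^ 2 / 2) / 3 ≤
      (gaussianReal 0 (Real.toNNReal (σ ^ 2))).real (Ici (σ * u)) := by
  have hv : Real.toNNReal (σ ^ 2) ≠ 0 := by positivity
  have hle : ∀ x ∈ Icc (σ * u) (σ * (u + 1)), ENNReal.ofReal (Real.exp (-(u + 1) ^ 2 / 2) / 3 / σ) ≤
      gaussianPDF 0 (Real.toNNReal (σ ^ 2)) x := by
    rintro x ⟨h1, h2⟩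
    rw [gaussianPDF]
    refine ENNReal.ofReal_le_ofReal ?_
    have hx : 0 ≤ x := le_trans (by positivity) h1
    have e : Real.exp (-(u + 1) ^ 2 / 2) / 3 / σ = (3 * σ)⁻¹ * Real.exp (-(u + 1) ^ 2 / 2) := by
      field_simp
    rw [gaussianPDFReal, Real.coe_toNNReal _ (sq_nonneg σ), sub_zero, e]
    refine mul_le_mul (inv_anti₀ (by positivity) ?_) (Real.exp_le_exp.2 ?_)
      (Real.exp_pos _).le (by positivity)
    · rw [Real.sqrt_le_left (by positivity)]
      nlinarith [Real.pi_lt_d2, sq_nonneg σ]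
    · rw [neg_div, neg_div, neg_le_neg_iff, div_le_div_iff₀ (by positivity) (by positivity)]
      have : x ^ 2 ≤ (σ * (u + 1)) ^ 2 := pow_le_pow_left₀ hx h2 2
      nlinarith
  rw [measureReal_def, ← ENNReal.ofReal_le_iff_le_toReal (measure_ne_top _ _)]
  calc ENNReal.ofReal (Real.exp (-(u + 1) ^ 2 / 2) / 3)
      = ∫⁻ _ in Icc (σ * u) (σ * (u + 1)), ENNReal.ofReal (Real.exp (-(u + 1) ^ 2 / 2) / 3 / σ) := by
        rw [setLIntegral_const, Real.volume_Icc, ← ENNReal.ofReal_mul (by positivity)]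
        congr 1; field_simp; ring
    _ ≤ ∫⁻ x in Icc (σ * u) (σ * (u + 1)), gaussianPDF 0 (Real.toNNReal (σ ^ 2)) x :=
        setLIntegral_mono' measurableSet_Icc hle
    _ = gaussianReal 0 (Real.toNNReal (σ ^ 2)) (Icc (σ * u) (σ * (u + 1))) :=
        (gaussianReal_apply 0 hv _).symm
    _ ≤ _ := measure_mono Icc_subset_Ici_self

end Gaussian

/-! ### Inequalities for large `n` -/

/-- The inequalities between `n` and the numbers `⌊n ^ c⌋`, `⌈n ^ c⌉` and `√(2 c ln n)`, for
`c = 1 / 5626`, that hold for all large `n`. -/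
structure IsLarge (n : ℕ) : Prop where
  eight_le : 8 ≤ ⌊(n : ℝ) ^ (1 / 5626 : ℝ)⌋₊
  two_mul_le : 2 * ⌈(n : ℝ) ^ (1 / 5626 : ℝ)⌉₊ ≤ n
  le_pow : n ≤ ⌊(n : ℝ) ^ (1 / 5626 : ℝ)⌋₊ ^ 11252
  one_lt : 1 < n
  exp_le : Real.exp (-(9 / 5 * √(2 * (1 / 5626) * Real.log n)) ^ 2 / 2) ≤
    1 / (⌊(n : ℝ) ^ (1 / 5626 : ℝ)⌋₊ : ℝ) ^ 2
  pow_le : (1 - Real.exp (-(297 / 5 * √(2 * (1 / 5626) * Real.log n) + 1) ^ 2 / 2) / 3) ^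
    (n - ⌈(n : ℝ) ^ (1 / 5626 : ℝ)⌉₊) ≤ 1 / (⌊(n : ℝ) ^ (1 / 5626 : ℝ)⌋₊ : ℝ)

-- The size of `c` matters in the last inequality. With `u = 297w/5` one has `u²/2 = (297/5)² c ln n
-- < 0.63 ln n`, which leaves room to bound `(u + 1)²/2` by `0.81 ln n`. About `n/2` trials of
-- success probability `n^(-0.81)/3` then all fail with probability at most `exp(-n^0.19/6) ≤ 1/n`.
set_option exponentiation.threshold 20000 in
lemma eventually_isLarge : ∀ᶠ n : ℕ in atTop, IsLarge n := by
  have hc := tendsto_natCast_atTop_atTop (R := ℝ)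
  have e1 := ((tendsto_rpow_atTop (show (0 : ℝ) < 1 / 5626 by norm_num)).comp hc).eventually
    (eventually_ge_atTop 9)
  have e2 := (Real.tendsto_log_atTop.comp hc).eventually (eventually_ge_atTop 100)
  have e3 := hc.eventually ((isLittleO_log_rpow_atTop
    (show (0 : ℝ) < 19 / 100 by norm_num)).bound (show (0 : ℝ) < 1 / 6 by norm_num))
  filter_upwards [e1, e2, e3, eventually_ge_atTop 16] with n h1 h2 h3 h4
  simp only [Function.comp_apply] at h1 h2
  have hn16 : (16 : ℝ) ≤ n := by exact_mod_cast h4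
  have hn : (0 : ℝ) < n := by linarith
  rw [Real.norm_of_nonneg (by linarith), Real.norm_of_nonneg (by positivity)] at h3
  set a : ℝ := (n : ℝ) ^ (1 / 5626 : ℝ) with ha
  have hfl : (⌊a⌋₊ : ℝ) ≤ a := Nat.floor_le (by linarith)
  have hfl' : a < ⌊a⌋₊ + 1 := Nat.lt_floor_add_one a
  have hm8 : 8 ≤ ⌊a⌋₊ := Nat.le_floor (by push_cast; linarith)
  have hm8' : (8 : ℝ) ≤ ⌊a⌋₊ := by exact_mod_cast hm8
  have hlog : Real.log a = 1 / 5626 * Real.log n := by rw [ha, Real.log_rpow hn]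
  have hM : (2 : ℝ) * ⌈a⌉₊ ≤ n := by
    have h5 : (⌈a⌉₊ : ℝ) < a + 1 := Nat.ceil_lt_add_one (by linarith)
    have h6 : a ≤ √n := by
      rw [ha, Real.sqrt_eq_rpow]
      exact Real.rpow_le_rpow_of_exponent_le (by linarith) (by norm_num)
    have h7 : (4 : ℝ) ≤ √n := Real.le_sqrt_of_sq_le (by linarith)
    have h8 := Real.mul_self_sqrt hn.le
    nlinarith
  refine ⟨hm8, by exact_mod_cast hM, ?_, by omega, ?_, ?_⟩
  -- Since `a ≥ 9`, rounding down leaves at least `√a`; this doubles the exponent `5626`.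
  · have hb : (n : ℝ) ^ (1 / 11252 : ℝ) ≤ ⌊a⌋₊ := by
      have : ((n : ℝ) ^ (1 / 11252 : ℝ)) ^ 2 = a := by
        rw [ha, ← Real.rpow_natCast, ← Real.rpow_mul hn.le]; norm_num
      have h0 : 0 ≤ (n : ℝ) ^ (1 / 11252 : ℝ) := by positivity
      nlinarith
    have := pow_le_pow_left₀ (by positivity : (0 : ℝ) ≤ (n : ℝ) ^ (1 / 11252 : ℝ)) hb 11252
    have e : ((n : ℝ) ^ (1 / 11252 : ℝ)) ^ 11252 = n := by
      rw [← Real.rpow_natCast, ← Real.rpow_mul hn.le]; norm_num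
    rw [e] at this
    exact_mod_cast this
  · rw [neg_div, mul_pow, Real.sq_sqrt (by linarith), Real.exp_neg,
      one_div ((⌊a⌋₊ : ℝ) ^ 2)]
    refine inv_anti₀ (pow_pos (by linarith : (0 : ℝ) < ⌊a⌋₊) 2) ?_
    calc (⌊a⌋₊ : ℝ) ^ 2 ≤ a ^ 2 := by gcongr
      _ = Real.exp (2 * Real.log a) := by
        rw [mul_comm, Real.exp_mul, Real.exp_log (by linarith)]; norm_cast
      _ ≤ _ := by
        rw [hlog]
        gcongr
        linarith
  · set p := Real.exp (-(297 / 5 * √(2 * (1 / 5626) * Real.log n) + 1) ^ 2 / 2) / 3 with hp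
    have hp1 : p ≤ 1 := by
      rw [hp, div_le_one (by norm_num)]
      refine (Real.exp_le_one_iff.2 ?_).trans (by norm_num)
      rw [neg_div]; exact neg_nonpos.2 (by positivity)
    have hp2 : (n : ℝ) ^ (-(81 / 100) : ℝ) / 3 ≤ p := by
      rw [hp, Real.rpow_def_of_pos hn]
      gcongr
      set w := √(2 * (1 / 5626) * Real.log n) with hw
      have hw2 : w ^ 2 = 2 * (1 / 5626) * Real.log n := Real.sq_sqrt (by linarith)
      -- With `u = 297w/5`, the square gives `2u ≤ u²/4 + 4`; the constant left over is absorbed by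
      -- `ln n ≥ 100`.
      nlinarith [sq_nonneg (297 / 5 * w / 4 - 1)]
    have hN : (n : ℝ) / 2 ≤ (n - ⌈a⌉₊ : ℕ) := by
      rw [Nat.cast_sub (by have : 2 * ⌈a⌉₊ ≤ n := by exact_mod_cast hM
                           omega)]
      linarith
    have hpos : (0 : ℝ) ≤ p := by positivity
    calc (1 - p) ^ (n - ⌈a⌉₊) ≤ Real.exp (-p) ^ (n - ⌈a⌉₊) := by
          refine pow_le_pow_left₀ (by linarith) ?_ _
          linarith [Real.add_one_le_exp (-p)]
      _ = Real.exp (-((n - ⌈a⌉₊ : ℕ) * p)) := by rw [← Real.exp_nat_mul]; ring_nf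
      _ ≤ Real.exp (-Real.log n) := by
          gcongr
          calc Real.log n ≤ 1 / 6 * (n : ℝ) ^ (19 / 100 : ℝ) := h3
            _ = (n : ℝ) / 2 * ((n : ℝ) ^ (-(81 / 100) : ℝ) / 3) := by
              have : (n : ℝ) ^ (19 / 100 : ℝ) = n * (n : ℝ) ^ (-(81 / 100) : ℝ) := by
                rw [← Real.rpow_one_add' hn.le (by norm_num)]; norm_num
              rw [this]; ring
            _ ≤ _ := by gcongr
      _ = 1 / n := by rw [Real.exp_neg, Real.exp_log hn, one_div]
      _ ≤ 1 / ⌊a⌋₊ := by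
          refine one_div_le_one_div_of_le (by linarith) (hfl.trans ?_)
          calc a ≤ (n : ℝ) ^ (1 : ℝ) :=
                Real.rpow_le_rpow_of_exponent_le (by linarith) (by norm_num)
            _ = n := Real.rpow_one _

/-! ### Marginals of the joint law -/

section Law

variable (D : Measure ℝ) {n : ℕ} (σ : Fin n → ℝ)

/-- The joint law of the noises. -/
noncomputable def noise : Measure (Fin n → ℝ) :=
  Measure.pi fun i : Fin n => gaussianReal 0 (Real.toNNReal (σ i ^ 2))

instance : IsProbabilityMeasure (noise σ) := by unfold noise; infer_instance

lemma law_eq : law D σ = (Measure.pi fun _ : Fin n => D).prod (noise σ) := rfl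

lemma measurePreserving_fst_law :
    MeasurePreserving Prod.fst (law D σ) (Measure.pi fun _ : Fin n => D) :=
  measurePreserving_fst

variable [IsProbabilityMeasure D]

instance : IsProbabilityMeasure (law D σ) := by unfold law; infer_instance

lemma measurePreserving_snd_law : MeasurePreserving Prod.snd (law D σ) (noise σ) :=
  measurePreserving_snd

lemma measurePreserving_X (i : Fin n) : MeasurePreserving (X i) (law D σ) D :=
  (measurePreserving_eval (fun _ : Fin n => D) i).comp (measurePreserving_fst_law D σ)

lemma measurePreserving_eps (i : Fin n) :
    MeasurePreserving (fun ω : (Fin n → ℝ) × (Fin n → ℝ) => ω.2 i) (law D σ)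
      (gaussianReal 0 (Real.toNNReal (σ i ^ 2))) :=
  (measurePreserving_eval (fun i : Fin n => gaussianReal 0 (Real.toNNReal (σ i ^ 2))) i).comp
    (measurePreserving_snd_law D σ)

variable {D}

lemma integrable_comp_X (i : Fin n) {f : ℝ → ℝ} (hf : Integrable f D) :
    Integrable (fun ω => f (X i ω)) (law D σ) :=
  (measurePreserving_X D σ i).integrable_comp_of_integrable hf

lemma integral_comp_X (i : Fin n) {f : ℝ → ℝ} (hf : AEStronglyMeasurable f D) :
    ∫ ω, f (X i ω) ∂(law D σ) = ∫ x, f x ∂D := by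
  have hp := measurePreserving_X D σ i
  conv_rhs => rw [← hp.map_eq]
  rw [integral_map hp.measurable.aemeasurable (by rwa [hp.map_eq])]

lemma ae_X {p : ℝ → Prop} (hp : ∀ᵐ x ∂D, p x) : ∀ᵐ ω ∂(law D σ), ∀ i, p (X i ω) :=
  ae_all_iff.2 fun i => (measurePreserving_X D σ i).quasiMeasurePreserving.ae hp

end Law

/-! ### Near ties among the noises -/

lemma measure_pi_le_of_section_le {ι : Type*} [Fintype ι] [DecidableEq ι] (μ : ι → Measure ℝ)
    [∀ i, IsProbabilityMeasure (μ i)] (i : ι) {B : Set (ι → ℝ)} (hB : MeasurableSet B)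
    {c : ENNReal} (h : ∀ x, μ i {t | Function.update x i t ∈ B} ≤ c) : Measure.pi μ B ≤ c := by
  have h1 : ∫⁻ x, B.indicator 1 x ∂(Measure.pi μ) ≤ ∫⁻ _, c ∂(Measure.pi μ) := by
    refine lintegral_le_of_lmarginal_le {i} (measurable_one.indicator hB) measurable_const
      fun x => ?_
    rw [lmarginal_singleton, lmarginal_singleton]
    simp only [lintegral_const, measure_univ, mul_one]
    refine le_trans (le_of_eq ?_) (h x)
    have hm : MeasurableSet {t | Function.update x i t ∈ B} := (measurable_update x) hB
    rw [← lintegral_indicator_one hm]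
    rfl
  rwa [lintegral_indicator_one hB, lintegral_const, measure_univ, mul_one] at h1

section NearTie

variable {n : ℕ} (σ : Fin n → ℝ) (T : Finset (Fin n)) (i : Fin n)

/-- The noise of box `i` comes within `x` of being the largest one in `T`, but is not the largest. -/
def nearTie (x : ℝ) : Set (Fin n → ℝ) :=
  {e | (∀ j ∈ T, j ≠ i → e j ≤ x + e i) ∧ ¬ ∀ j ∈ T, j ≠ i → e j < e i}

/-- The noise of box `i` is the strict maximum in `T`. -/
def strictMax : Set (Fin n → ℝ) := {e | ∀ j ∈ T, j ≠ i → e j < e i}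

lemma measurableSet_strictMax : MeasurableSet (strictMax T i) := by
  unfold strictMax
  simp only [ofPred_forall]
  exact Finset.measurableSet_biInter _ fun j _ => MeasurableSet.iInter fun _ =>
    measurableSet_lt (measurable_pi_apply j) (measurable_pi_apply i)

lemma measurableSet_nearTie_prod :
    MeasurableSet {ω : (Fin n → ℝ) × (Fin n → ℝ) | ω.2 ∈ nearTie T i (ω.1 i)} := by
  have h1 : MeasurableSet {ω : (Fin n → ℝ) × (Fin n → ℝ) |
      ∀ j ∈ T, j ≠ i → ω.2 j ≤ ω.1 i + ω.2 i} := by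
    simp only [ofPred_forall]
    exact Finset.measurableSet_biInter _ fun j _ => MeasurableSet.iInter fun _ =>
      measurableSet_le (by fun_prop) (by fun_prop)
  exact h1.inter ((measurableSet_strictMax T i).preimage measurable_snd).compl

/-- Once the other noises are fixed, the noise of box `i` lies in an interval of length `x` ending
at their maximum, and its density is at most `1/σ i`. -/
lemma noise_nearTie_le (hσ : 0 < σ i) (x : ℝ) :
    noise σ (nearTie T i x) ≤ ENNReal.ofReal (x / σ i) := by
  have hm : MeasurableSet (nearTie T i x) :=
    (measurableSet_nearTie_prod T i).preimage (f := fun e => ((fun _ => x), e)) (by fun_prop)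
  refine measure_pi_le_of_section_le _ i hm fun e => ?_
  by_cases hne : ∃ j ∈ T, j ≠ i
  · obtain ⟨k, hk, hmax⟩ := Finset.exists_max_image (T.filter (· ≠ i)) e
      (by obtain ⟨j, hj, hji⟩ := hne; exact ⟨j, by simp [hj, hji]⟩)
    simp only [Finset.mem_filter] at hk hmax
    have := gaussianReal_Icc_le hσ (e k - x) (e k)
    rw [sub_sub_cancel] at this
    refine (measure_mono ?_).trans this
    rintro t ⟨h1, h2⟩
    push Not at h2
    obtain ⟨j, hj, hji, hle⟩ := h2
    have h3 := h1 k hk.1 hk.2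
    simp only [Function.update_self, Function.update_of_ne hk.2, Function.update_of_ne hji]
      at h3 hle
    exact ⟨by linarith, hle.trans (hmax j ⟨hj, hji⟩)⟩
  · have : {t | Function.update e i t ∈ nearTie T i x} = ∅ := by
      ext t
      simp only [mem_ofPred_eq, mem_empty_iff_false, iff_false]
      rintro ⟨-, h2⟩
      exact h2 fun j hj hji => absurd ⟨j, hj, hji⟩ hne
    rw [this]; simp

end NearTie

section BestNoise

variable {D : Measure ℝ} [IsProbabilityMeasure D] {n : ℕ} (σ : Fin n → ℝ) (T : Finset (Fin n))

/-- Conditionally on `X i`, a near tie has probability at most `X i / σ i`, so the second moment of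
`D` appears. -/
lemma integral_X_nearTie_le (h : IsNBU D) {i : Fin n} (hσ : 0 < σ i) :
    ∫ ω, {ω : (Fin n → ℝ) × (Fin n → ℝ) | ω.2 ∈ nearTie T i (ω.1 i)}.indicator (X i) ω ∂(law D σ)
      ≤ 8 * mean D ^ 2 / σ i := by
  have hm := measurableSet_nearTie_prod T i
  have hX : Measurable (X i) := (measurePreserving_X D σ i).measurable
  rw [integral_eq_lintegral_of_nonneg_ae ?_ (hX.indicator hm).aestronglyMeasurable]
  swap
  · filter_upwards [ae_X σ h.ae_nonneg] with ω hω
    exact indicator_apply_nonneg fun _ => hω i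
  refine ENNReal.toReal_le_of_le_ofReal (by positivity) ?_
  rw [law_eq, lintegral_prod _ (hX.indicator hm).ennreal_ofReal.aemeasurable]
  calc _ ≤ ∫⁻ x, ENNReal.ofReal (x i ^ 2 / σ i) ∂(Measure.pi fun _ : Fin n => D) := by
        refine lintegral_mono_ae ?_
        filter_upwards [ae_pi_eval (fun _ : Fin n => D) (p := fun _ x => 0 ≤ x)
          fun _ => h.ae_nonneg] with x hx
        have hmx : MeasurableSet (nearTie T i (x i)) :=
          hm.preimage (f := fun e => (x, e)) (by fun_prop)
        calc _ = ∫⁻ e, (nearTie T i (x i)).indicator (fun _ => ENNReal.ofReal (x i)) e ∂noise σ := by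
              refine lintegral_congr fun e => ?_
              by_cases he : e ∈ nearTie T i (x i)
              · rw [indicator_of_mem he, indicator_of_mem (by exact he)]; rfl
              · rw [indicator_of_notMem he, indicator_of_notMem (by exact he)]; simp
          _ = ENNReal.ofReal (x i) * noise σ (nearTie T i (x i)) := by
              rw [lintegral_indicator_const hmx]
          _ ≤ ENNReal.ofReal (x i) * ENNReal.ofReal (x i / σ i) := by
              gcongr
              exact noise_nearTie_le σ T i hσ (x i)
          _ = _ := by
              rw [← ENNReal.ofReal_mul (hx i)]
              congr 1; ring
    _ = ∫⁻ x, ENNReal.ofReal (x ^ 2 / σ i) ∂D :=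
        (measurePreserving_eval (fun _ : Fin n => D) i).lintegral_comp
          (f := fun t => ENNReal.ofReal (t ^ 2 / σ i)) (by fun_prop)
    _ = ∫⁻ x, ENNReal.ofReal (x ^ 2) * ENNReal.ofReal (1 / σ i) ∂D := by
        refine lintegral_congr fun x => ?_
        rw [← ENNReal.ofReal_mul (sq_nonneg x)]
        congr 1; ring
    _ ≤ ENNReal.ofReal (8 * mean D ^ 2) * ENNReal.ofReal (1 / σ i) := by
        rw [lintegral_mul_const _ (by fun_prop)]
        gcongr
        exact h.lintegral_sq_le
    _ = _ := by
        rw [← ENNReal.ofReal_mul (by positivity)]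
        congr 1; ring

lemma sum_strictMax_le (e : Fin n → ℝ) :
    ∑ i ∈ T, (strictMax T i).indicator (fun _ => (1 : ℝ)) e ≤ 1 := by
  by_cases hex : ∃ i ∈ T, e ∈ strictMax T i
  · obtain ⟨i, hi, he⟩ := hex
    rw [Finset.sum_eq_single i]
    · rw [indicator_of_mem he]
    · intro j hj hji
      refine indicator_of_notMem (fun hj' => ?_) _
      exact lt_asymm (he j hj hji) (hj' i hi hji.symm)
    · exact fun hi' => absurd hi hi'
  · rw [Finset.sum_eq_zero]
    · norm_num
    · intro i hi
      exact indicator_of_notMem (fun he => hex ⟨i, hi, he⟩) _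

lemma integrable_X_mul_strictMax (h : IsNBU D) (i : Fin n) :
    Integrable (fun ω => X i ω * (strictMax T i).indicator (fun _ => (1 : ℝ)) ω.2) (law D σ) := by
  refine (integrable_comp_X σ i h.integrable_id).mul_bdd (c := 1)
    (((measurable_const.indicator (measurableSet_strictMax T i)).comp
      measurable_snd).aestronglyMeasurable) (Eventually.of_forall fun ω => ?_)
  rw [Real.norm_eq_abs]
  unfold indicator
  split_ifs <;> simp

/-- Which noise is largest is independent of the rewards, and at most one noise is the strict
maximum. -/
lemma sum_integral_X_strictMax_le (h : IsNBU D) :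
    ∑ i ∈ T, ∫ ω, X i ω * (strictMax T i).indicator (fun _ => (1 : ℝ)) ω.2 ∂(law D σ)
      ≤ mean D := by
  have e : ∀ i ∈ T, ∫ ω, X i ω * (strictMax T i).indicator (fun _ => (1 : ℝ)) ω.2 ∂(law D σ) =
      mean D * ∫ e, (strictMax T i).indicator (fun _ => (1 : ℝ)) e ∂noise σ := by
    intro i _
    rw [law_eq]
    have := integral_prod_mul (μ := Measure.pi fun _ : Fin n => D) (ν := noise σ)
      (fun x => x i) (fun e => (strictMax T i).indicator (fun _ => (1 : ℝ)) e)
    rw [integral_pi_eval (fun _ => D) i (f := fun x => x) (by fun_prop)] at this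
    exact this
  have hi : ∀ i ∈ T, Integrable (fun e => (strictMax T i).indicator (fun _ => (1 : ℝ)) e)
      (noise σ) := fun i _ => (integrable_const _).indicator (measurableSet_strictMax T i)
  rw [Finset.sum_congr rfl e, ← Finset.mul_sum, ← integral_finsetSum _ hi]
  refine mul_le_of_le_one_right h.mean_pos.le ?_
  calc _ ≤ ∫ _, (1 : ℝ) ∂noise σ := integral_mono (integrable_finsetSum _ hi)
        (integrable_const _) fun e => sum_strictMax_le T e
    _ = 1 := by simp

end BestNoise

/-! ### The instance with two noise scales -/

/-- Box `0` has no noise, the other boxes up to box `M - 1` have standard deviation `s`, and the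
remaining ones have standard deviation `S`. -/
def twoScale (n M : ℕ) (s S : ℝ) : Fin n → ℝ :=
  fun i => if (i : ℕ) = 0 then 0 else if (i : ℕ) < M then s else S

/-- The boxes with standard deviation `s`. -/
def smallBoxes (n M : ℕ) : Finset (Fin n) := Finset.univ.filter fun i => (i : ℕ) ≠ 0 ∧ (i : ℕ) < M

/-- The boxes with standard deviation `S`. -/
def bigBoxes (n M : ℕ) : Finset (Fin n) := Finset.univ.filter fun i => (i : ℕ) ≠ 0 ∧ M ≤ (i : ℕ)

section TwoScale

variable {n M : ℕ} {s S : ℝ}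

lemma mem_smallBoxes {i : Fin n} : i ∈ smallBoxes n M ↔ (i : ℕ) ≠ 0 ∧ (i : ℕ) < M := by
  simp [smallBoxes]

lemma mem_bigBoxes {i : Fin n} : i ∈ bigBoxes n M ↔ (i : ℕ) ≠ 0 ∧ M ≤ (i : ℕ) := by
  simp [bigBoxes]

lemma twoScale_zero {i : Fin n} (hi : (i : ℕ) = 0) : twoScale n M s S i = 0 := by
  simp [twoScale, hi]

lemma twoScale_small {i : Fin n} (hi : i ∈ smallBoxes n M) : twoScale n M s S i = s := by
  rw [mem_smallBoxes] at hi
  simp [twoScale, hi.1, hi.2]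

lemma twoScale_big {i : Fin n} (hi : i ∈ bigBoxes n M) : twoScale n M s S i = S := by
  rw [mem_bigBoxes] at hi
  simp [twoScale, hi.1, not_lt.2 hi.2]

lemma card_smallBoxes (hM : M ≤ n) : (smallBoxes n M).card = M - 1 := by
  have : (smallBoxes n M).map Fin.valEmbedding = Finset.Ico 1 M := by
    ext k
    simp only [Finset.mem_map, mem_smallBoxes, Fin.valEmbedding_apply, Finset.mem_Ico]
    constructor
    · rintro ⟨i, hi, rfl⟩; omega
    · intro hk; exact ⟨⟨k, by omega⟩, by simp; omega, rfl⟩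
  rw [← Finset.card_map, this, Nat.card_Ico]

lemma card_bigBoxes (hM0 : 0 < M) : (bigBoxes n M).card = n - M := by
  have : (bigBoxes n M).map Fin.valEmbedding = Finset.Ico M n := by
    ext k
    simp only [Finset.mem_map, mem_bigBoxes, Fin.valEmbedding_apply, Finset.mem_Ico]
    constructor
    · rintro ⟨i, hi, rfl⟩; omega
    · intro hk; exact ⟨⟨k, by omega⟩, by simp; omega, rfl⟩
  rw [← Finset.card_map, this, Nat.card_Ico]

lemma twoScale_nonneg (hs : 0 ≤ s) (hS : s ≤ S) (i : Fin n) : 0 ≤ twoScale n M s S i := by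
  unfold twoScale
  split_ifs <;> linarith

lemma monotone_twoScale (hs : 0 ≤ s) (hS : s ≤ S) : Monotone (twoScale n M s S) := by
  intro i j hij
  have : (i : ℕ) ≤ j := hij
  unfold twoScale
  split_ifs <;> first | linarith | omega

/-- If a linear policy selects a box with small noise, then the value of this box is at least the
value at `s` of the line through the origin and any of the boxes with large noise. -/
lemma Policy.IsLinear.le_of_small {A : Policy n} {γ : (Fin n → ℝ) → (Fin n → ℝ) → ℝ}
    (hA : A.IsLinear γ) (hs : 0 ≤ s) (hS : s ≤ S) {x ε : Fin n → ℝ} (hx : ∀ i, 0 ≤ x i)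
    {i₀ i j : Fin n} (hi₀ : (i₀ : ℕ) = 0) (hi : i ∈ smallBoxes n M) (hj : j ∈ bigBoxes n M)
    (h : A.prob (twoScale n M s S) (fun k => x k + ε k) i ≠ 0) (hε : ε i₀ = 0) :
    s * ε j ≤ S * (x i + ε i) := by
  have h0 := hA _ _ i h i₀
  have h1 := hA _ _ i h j
  rw [twoScale_zero hi₀, twoScale_small hi, hε] at h0
  rw [twoScale_big hj, twoScale_small hi] at h1
  have a := mul_le_mul_of_nonneg_left h0 (sub_nonneg.2 hS)
  have b := mul_le_mul_of_nonneg_left h1 hs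
  have := mul_nonneg (sub_nonneg.2 hS) (hx i₀)
  have := mul_nonneg hs (hx j)
  nlinarith

end TwoScale

/-! ### Upper bound on the reward of linear policies -/

/-- A box with small noise has an observation of at least `K`, or all boxes with large noise have
a noise below `L`. -/
def smallSelectable (n M : ℕ) (K L : ℝ) : Set ((Fin n → ℝ) × (Fin n → ℝ)) :=
  (⋃ i ∈ smallBoxes n M, {ω | K ≤ ω.1 i + ω.2 i}) ∪ {ω | ∀ j ∈ bigBoxes n M, ω.2 j < L}

lemma measurableSet_smallSelectable (n M : ℕ) (K L : ℝ) :
    MeasurableSet (smallSelectable n M K L) := by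
  refine MeasurableSet.union (Finset.measurableSet_biUnion _ fun i _ =>
    measurableSet_le (by fun_prop) (by fun_prop)) ?_
  simp only [ofPred_forall]
  exact Finset.measurableSet_biInter _ fun j _ => measurableSet_lt (by fun_prop) (by fun_prop)

section Reward

variable {D : Measure ℝ} [IsProbabilityMeasure D] {n : ℕ}

lemma measureReal_obs_ge_le (σ : Fin n → ℝ) (i : Fin n) {a b : ℝ} (hb : 0 < b) :
    (law D σ).real {ω | a + b ≤ ω.1 i + ω.2 i} ≤
      D.real (Ioi a) + Real.exp (-b ^ 2 / (2 * σ i ^ 2)) := by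
  have hsub : {ω : (Fin n → ℝ) × (Fin n → ℝ) | a + b ≤ ω.1 i + ω.2 i} ⊆
      X i ⁻¹' (Ioi a) ∪ (fun ω => ω.2 i) ⁻¹' (Ici b) := by
    intro ω hω
    by_contra hc
    simp only [mem_union, mem_preimage, mem_Ici, mem_Ioi, not_lt, not_or, not_le, X] at hc
    have : a + b ≤ ω.1 i + ω.2 i := hω
    linarith
  refine (measureReal_mono hsub).trans ((measureReal_union_le _ _).trans ?_)
  gcongr
  · rw [measureReal_def, measureReal_def,
      (measurePreserving_X D σ i).measure_preimage measurableSet_Ioi.nullMeasurableSet]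
  · rw [measureReal_def,
      (measurePreserving_eps D σ i).measure_preimage measurableSet_Ici.nullMeasurableSet]
    exact gaussianReal_Ici_le hb.le

lemma measureReal_noise_lt_le (σ : Fin n → ℝ) (T : Finset (Fin n)) {S u : ℝ} (hS : 0 < S)
    (hu : 0 ≤ u) (hT : ∀ j ∈ T, σ j = S) :
    (law D σ).real {ω | ∀ j ∈ T, ω.2 j < S * u} ≤
      (1 - Real.exp (-(u + 1) ^ 2 / 2) / 3) ^ T.card := by
  set B : Set (Fin n → ℝ) := Set.univ.pi fun j => if j ∈ T then Iio (S * u) else univ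
  have hB : {ω : (Fin n → ℝ) × (Fin n → ℝ) | ∀ j ∈ T, ω.2 j < S * u} = Prod.snd ⁻¹' B := by
    ext ω
    simp only [mem_ofPred_eq, B, mem_preimage, Set.mem_pi, mem_univ, true_implies]
    refine forall_congr' fun j => ?_
    by_cases hj : j ∈ T <;> simp [hj]
  have hBm : MeasurableSet B := MeasurableSet.univ_pi fun j => by
    split_ifs
    exacts [measurableSet_Iio, MeasurableSet.univ]
  rw [hB, measureReal_def, (measurePreserving_snd_law D σ).measure_preimage hBm.nullMeasurableSet,
    noise, Measure.pi_pi, ENNReal.toReal_prod]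
  have e : ∀ j, (gaussianReal 0 (Real.toNNReal (σ j ^ 2))
      (if j ∈ T then Iio (S * u) else univ)).toReal =
      if j ∈ T then 1 - (gaussianReal 0 (Real.toNNReal (S ^ 2))).real (Ici (S * u)) else 1 := by
    intro j
    split_ifs with hj
    · rw [hT j hj, ← measureReal_def, ← compl_Ici, probReal_compl_eq_one_sub measurableSet_Ici]
    · simp
  simp only [e]
  rw [Finset.prod_ite_mem, Finset.univ_inter, Finset.prod_const]
  refine pow_le_pow_left₀ (sub_nonneg.2 measureReal_le_one) ?_ _
  linarith [le_gaussianReal_Ici hS hu]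

lemma measureReal_smallSelectable_le {M : ℕ} (hM0 : 0 < M) (hM : M ≤ n) {s S a b u : ℝ} (hS : 0 < S) (hb : 0 < b) (hu : 0 ≤ u) :
    (law D (twoScale n M s S)).real (smallSelectable n M (a + b) (S * u)) ≤
      (M - 1 : ℕ) * (D.real (Ioi a) + Real.exp (-b ^ 2 / (2 * s ^ 2))) +
        (1 - Real.exp (-(u + 1) ^ 2 / 2) / 3) ^ (n - M) := by
  refine (measureReal_union_le _ _).trans (add_le_add ?_ ?_)
  · refine (measureReal_biUnion_finset_le _ _).trans ?_
    rw [← card_smallBoxes hM, ← nsmul_eq_mul]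
    refine Finset.sum_le_card_nsmul _ _ _ fun i hi => ?_
    have := measureReal_obs_ge_le (D := D) (twoScale n M s S) i (a := a) hb
    rwa [twoScale_small hi] at this
  · rw [← card_bigBoxes hM0]
    exact measureReal_noise_lt_le _ _ hS hu fun j hj => twoScale_big hj

/-- The pointwise bound on the reward of a linear policy. -/
lemma Policy.IsLinear.sum_mul_le {A : Policy n} {γ : (Fin n → ℝ) → (Fin n → ℝ) → ℝ}
    (hA : A.IsLinear γ) {M : ℕ} {s S u K : ℝ} (hs : 0 < s) (hS : s ≤ S) (hK : 0 < K)
    {x ε : Fin n → ℝ} (hx : ∀ i, 0 ≤ x i) {i₀ : Fin n} (hi₀ : (i₀ : ℕ) = 0) (hε : ε i₀ = 0) :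
    ∑ i, A.prob (twoScale n M s S) (fun k => x k + ε k) i * x i ≤
      x i₀ + ∑ i ∈ bigBoxes n M, (x i * (strictMax (bigBoxes n M) i).indicator (fun _ => 1) ε +
        {ω : (Fin n → ℝ) × (Fin n → ℝ) |
          ω.2 ∈ nearTie (bigBoxes n M) i (ω.1 i)}.indicator (X i) (x, ε)) +
      ∑ i ∈ smallBoxes n M, x i ^ 2 / (2 * K) +
      K / 2 * (smallSelectable n M (s * u) (S * u)).indicator (fun _ => 1) (x, ε) := by
  set y : Fin n → ℝ := fun k => x k + ε k with hy
  set σ := twoScale n M s S with hσ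
  set F : ℝ := (smallSelectable n M (s * u) (S * u)).indicator (fun _ => 1) (x, ε) with hF
  set p := A.prob σ y with hp
  have hp0 : ∀ i, 0 ≤ p i := A.prob_nonneg σ y
  have hpsum : ∑ i, p i = 1 := A.prob_sum σ y
  have hp1 : ∀ i, p i ≤ 1 := fun i => hpsum ▸ Finset.single_le_sum (fun j _ => hp0 j)
    (Finset.mem_univ i)
  have hF0 : 0 ≤ F := indicator_nonneg (fun _ _ => zero_le_one) _
  have hnear : ∀ i, 0 ≤ {ω : (Fin n → ℝ) × (Fin n → ℝ) |
      ω.2 ∈ nearTie (bigBoxes n M) i (ω.1 i)}.indicator (X i) (x, ε) := fun i =>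
    indicator_apply_nonneg fun _ => hx i
  have hstrict : ∀ i, 0 ≤ x i * (strictMax (bigBoxes n M) i).indicator (fun _ => (1 : ℝ)) ε :=
    fun i => mul_nonneg (hx i) (indicator_nonneg (fun _ _ => zero_le_one) _)
  have hsplit : (Finset.univ : Finset (Fin n)) =
      insert i₀ (bigBoxes n M ∪ smallBoxes n M) := by
    ext i
    simp only [Finset.mem_univ, Finset.mem_insert, Finset.mem_union, mem_bigBoxes, mem_smallBoxes,
      true_iff, Fin.ext_iff]
    omega
  have hdisj : Disjoint (bigBoxes n M) (smallBoxes n M) := by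
    rw [Finset.disjoint_left]
    intro i
    rw [mem_bigBoxes, mem_smallBoxes]
    omega
  have hi₀' : i₀ ∉ bigBoxes n M ∪ smallBoxes n M := by
    simp [mem_bigBoxes, mem_smallBoxes, hi₀]
  -- Big boxes share one standard deviation, so `γ` cancels between them: a selected box maximizes
  -- `x + ε` over the big boxes. As rewards are non-negative, no big noise exceeds its own by more
  -- than `x i`.
  have hbig : ∀ i ∈ bigBoxes n M, p i * x i ≤
      x i * (strictMax (bigBoxes n M) i).indicator (fun _ => 1) ε +
        {ω : (Fin n → ℝ) × (Fin n → ℝ) |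
          ω.2 ∈ nearTie (bigBoxes n M) i (ω.1 i)}.indicator (X i) (x, ε) := by
    intro i hi
    rcases eq_or_ne (p i) 0 with h0 | h0
    · rw [h0, zero_mul]; exact add_nonneg (hstrict i) (hnear i)
    refine (mul_le_of_le_one_left (hx i) (hp1 i)).trans ?_
    by_cases hmax : ε ∈ strictMax (bigBoxes n M) i
    · rw [indicator_of_mem hmax, mul_one]
      linarith [hnear i]
    · have hmem : (x, ε) ∈ {ω : (Fin n → ℝ) × (Fin n → ℝ) |
          ω.2 ∈ nearTie (bigBoxes n M) i (ω.1 i)} := by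
        refine ⟨fun j hj _ => ?_, hmax⟩
        have := hA σ y i h0 j
        rw [hσ, twoScale_big hi, twoScale_big hj, hy] at this
        have := hx j
        dsimp only
        linarith
      rw [indicator_of_mem hmem]
      exact le_add_of_nonneg_left (hstrict i)
  have hsmall : ∀ i ∈ smallBoxes n M, p i * x i ≤ x i ^ 2 / (2 * K) + p i * (K / 2 * F) := by
    intro i hi
    rcases eq_or_ne (p i) 0 with h0 | h0
    · rw [h0, zero_mul, zero_mul, add_zero]; positivity
    have hmem : (x, ε) ∈ smallSelectable n M (s * u) (S * u) := by
      by_contra hc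
      simp only [smallSelectable, mem_union, mem_iUnion, mem_ofPred_eq, not_or, not_exists,
        not_le, not_forall, not_lt] at hc
      obtain ⟨h1, j, hj, hju⟩ := hc
      have h2 := hA.le_of_small hs.le hS hx hi₀ hi hj h0 hε
      have h3 := h1 i hi
      have h4 : s * (S * u) ≤ S * (x i + ε i) := (mul_le_mul_of_nonneg_left hju hs.le).trans h2
      have h5 : S * (x i + ε i) < S * (s * u) := mul_lt_mul_of_pos_left h3 (hs.trans_le hS)
      linarith
    rw [hF, indicator_of_mem hmem, mul_one]
    -- This splits off a term that is summed over all small boxes without the selection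
    -- probabilities, so that only the constant `K / 2` is charged to the rare event.
    have hamgm : x i ≤ x i ^ 2 / (2 * K) + K / 2 := by
      rw [← sub_nonneg]
      have : x i ^ 2 / (2 * K) + K / 2 - x i = (x i - K) ^ 2 / (2 * K) := by field_simp; ring
      rw [this]; positivity
    calc p i * x i ≤ p i * (x i ^ 2 / (2 * K) + K / 2) := by gcongr; exact hp0 i
      _ = p i * (x i ^ 2 / (2 * K)) + p i * (K / 2) := mul_add _ _ _
      _ ≤ _ := by
        gcongr
        exact mul_le_of_le_one_left (by positivity) (hp1 i)
  have hps : ∑ i ∈ smallBoxes n M, p i ≤ 1 := hpsum ▸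
    Finset.sum_le_univ_sum_of_nonneg hp0
  rw [hsplit, Finset.sum_insert hi₀', Finset.sum_union hdisj]
  have h1 : p i₀ * x i₀ ≤ x i₀ := mul_le_of_le_one_left (hx _) (hp1 _)
  have h2 := Finset.sum_le_sum hbig
  have h3 := Finset.sum_le_sum hsmall
  rw [Finset.sum_add_distrib, ← Finset.sum_mul] at h3
  have h4 : (∑ i ∈ smallBoxes n M, p i) * (K / 2 * F) ≤ K / 2 * F :=
    mul_le_of_le_one_left (by positivity) hps
  linarith

end Reward

section LinearReward

variable {D : Measure ℝ} [IsProbabilityMeasure D] {n : ℕ}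

lemma reward_le_of_isLinear (h : IsNBU D) {A : Policy n} {γ : (Fin n → ℝ) → (Fin n → ℝ) → ℝ}
    (hA : A.IsLinear γ) (hn : 0 < n) {M : ℕ} {s S u K : ℝ} (hs : 0 < s) (hS : s ≤ S)
    (hK : 0 < K) :
    reward D (twoScale n M s S) A ≤ mean D + (mean D + n * (8 * mean D ^ 2 / S)) +
      (smallBoxes n M).card * (8 * mean D ^ 2 / (2 * K)) +
      K / 2 * (law D (twoScale n M s S)).real (smallSelectable n M (s * u) (S * u)) := by
  set σ := twoScale n M s S with hσ
  have hS0 : 0 < S := hs.trans_le hS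
  let i₀ : Fin n := ⟨0, hn⟩
  have hx := ae_X σ h.ae_nonneg
  -- A Gaussian of variance zero is a Dirac mass.
  have hε : ∀ᵐ ω ∂law D σ, ω.2 i₀ = 0 := by
    refine (measurePreserving_eps D σ i₀).quasiMeasurePreserving.ae (p := fun t => t = 0) ?_
    rw [hσ, twoScale_zero rfl]
    simp [ae_dirac_eq]
  have i1 := integrable_comp_X σ i₀ h.integrable_id
  have i2 : ∀ i, Integrable (fun ω => X i ω *
      (strictMax (bigBoxes n M) i).indicator (fun _ => (1 : ℝ)) ω.2) (law D σ) :=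
    fun i => integrable_X_mul_strictMax σ _ h i
  have i3 : ∀ i, Integrable ({ω : (Fin n → ℝ) × (Fin n → ℝ) |
      ω.2 ∈ nearTie (bigBoxes n M) i (ω.1 i)}.indicator (X i)) (law D σ) :=
    fun i => (integrable_comp_X σ i h.integrable_id).indicator (measurableSet_nearTie_prod _ i)
  have i4 : ∀ i, Integrable (fun ω => X i ω ^ 2 / (2 * K)) (law D σ) :=
    fun i => (integrable_comp_X σ i h.integrable_sq).div_const _
  have i5 : Integrable ((smallSelectable n M (s * u) (S * u)).indicator fun _ => (1 : ℝ))
      (law D σ) := (integrable_const _).indicator (measurableSet_smallSelectable _ _ _ _)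
  have i23 : ∀ i, Integrable (fun ω => X i ω *
      (strictMax (bigBoxes n M) i).indicator (fun _ => (1 : ℝ)) ω.2 +
        {ω : (Fin n → ℝ) × (Fin n → ℝ) |
          ω.2 ∈ nearTie (bigBoxes n M) i (ω.1 i)}.indicator (X i) ω) (law D σ) :=
    fun i => (i2 i).add (i3 i)
  have j2 := integrable_finsetSum (bigBoxes n M) fun i _ => i23 i
  have j4 := integrable_finsetSum (smallBoxes n M) fun i _ => i4 i
  have j12 := i1.fun_add j2
  have j124 := j12.fun_add j4
  have key : reward D σ A ≤ ∫ ω, (X i₀ ω + ∑ i ∈ bigBoxes n M,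
      (X i ω * (strictMax (bigBoxes n M) i).indicator (fun _ => 1) ω.2 +
        {ω : (Fin n → ℝ) × (Fin n → ℝ) |
          ω.2 ∈ nearTie (bigBoxes n M) i (ω.1 i)}.indicator (X i) ω) +
      ∑ i ∈ smallBoxes n M, X i ω ^ 2 / (2 * K) +
      K / 2 * (smallSelectable n M (s * u) (S * u)).indicator (fun _ => 1) ω) ∂law D σ := by
    refine integral_mono_of_nonneg ?_ (j124.fun_add (i5.const_mul _)) ?_
    · filter_upwards [hx] with ω hω
      exact Finset.sum_nonneg fun i _ => mul_nonneg (A.prob_nonneg _ _ _) (hω i)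
    · filter_upwards [hx, hε] with ω hω hω0
      exact hA.sum_mul_le hs hS hK hω rfl hω0
  refine key.trans ?_
  rw [integral_add j124 (i5.const_mul _), integral_add j12 j4,
    integral_add i1 j2, integral_finsetSum _ fun i _ => i23 i,
    integral_finsetSum _ fun i _ => i4 i, integral_const_mul,
    integral_indicator_const _ (measurableSet_smallSelectable _ _ _ _), smul_eq_mul, mul_one]
  have e1 : ∫ ω, X i₀ ω ∂law D σ = mean D :=
    integral_comp_X σ i₀ (f := fun x => x) (by fun_prop)
  have e2 : ∑ i ∈ bigBoxes n M, ∫ ω,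
      (X i ω * (strictMax (bigBoxes n M) i).indicator (fun _ => 1) ω.2 +
        {ω : (Fin n → ℝ) × (Fin n → ℝ) |
          ω.2 ∈ nearTie (bigBoxes n M) i (ω.1 i)}.indicator (X i) ω) ∂law D σ ≤
      mean D + n * (8 * mean D ^ 2 / S) := by
    rw [Finset.sum_congr rfl fun i _ => integral_add (i2 i) (i3 i), Finset.sum_add_distrib]
    refine add_le_add (sum_integral_X_strictMax_le σ _ h) ?_
    calc _ ≤ ∑ i ∈ bigBoxes n M, 8 * mean D ^ 2 / S := by
          refine Finset.sum_le_sum fun i hi => ?_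
          have e : σ i = S := twoScale_big hi
          have := integral_X_nearTie_le σ (bigBoxes n M) h (i := i) (by rwa [e])
          rwa [e] at this
      _ ≤ _ := by
          rw [Finset.sum_const, nsmul_eq_mul]
          gcongr
          simpa using (bigBoxes n M).card_le_univ
  have e4 : ∑ i ∈ smallBoxes n M, ∫ ω, X i ω ^ 2 / (2 * K) ∂law D σ ≤
      (smallBoxes n M).card * (8 * mean D ^ 2 / (2 * K)) := by
    rw [← nsmul_eq_mul]
    refine Finset.sum_le_card_nsmul _ _ _ fun i _ => ?_
    rw [integral_div, integral_comp_X σ i (f := fun x => x ^ 2) (by fun_prop)]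
    gcongr
    exact h.integral_sq_le
  rw [e1]
  exact add_le_add_left (add_le_add (add_le_add_right e2 _) e4) _

end LinearReward

/-! ### The hard instance and its linear reward -/

/-- The standard deviation allowed by the small noise condition for `c = 1 / 5626`. -/
noncomputable def smallSD (D : Measure ℝ) (n : ℕ) : ℝ :=
  expectedMax D ⌊(n : ℝ) ^ (1 / 5626 : ℝ)⌋₊ / (18 * √(2 * (1 / 5626) * Real.log n))

/-- A vector of standard deviations for which all linear policies are bad. -/
noncomputable def hardSD (D : Measure ℝ) (n : ℕ) : Fin n → ℝ :=
  twoScale n ⌈(n : ℝ) ^ (1 / 5626 : ℝ)⌉₊ (smallSD D n) (n * mean D + smallSD D n)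

section Hard

variable {D : Measure ℝ} [IsProbabilityMeasure D] {n : ℕ}

lemma IsLarge.sqrt_pos (hn : IsLarge n) : 0 < √(2 * (1 / 5626) * Real.log n) := by
  have : 0 < Real.log n := Real.log_pos (by exact_mod_cast hn.one_lt)
  positivity

lemma IsLarge.eight_le_ceil (hn : IsLarge n) : 8 ≤ ⌈(n : ℝ) ^ (1 / 5626 : ℝ)⌉₊ :=
  hn.eight_le.trans (Nat.floor_le_ceil _)

lemma IsLarge.card_smallBoxes_le (hn : IsLarge n) :
    (smallBoxes n ⌈(n : ℝ) ^ (1 / 5626 : ℝ)⌉₊).card ≤ ⌊(n : ℝ) ^ (1 / 5626 : ℝ)⌋₊ := by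
  have h1 := hn.two_mul_le
  rw [card_smallBoxes (by omega)]
  have := Nat.ceil_le_floor_add_one ((n : ℝ) ^ (1 / 5626 : ℝ))
  omega

lemma IsLarge.le_card_smallBoxes (hn : IsLarge n) :
    ⌊(n : ℝ) ^ (1 / 5626 : ℝ)⌋₊ ≤ (smallBoxes n ⌈(n : ℝ) ^ (1 / 5626 : ℝ)⌉₊).card + 1 := by
  have h1 := hn.two_mul_le
  have h2 := hn.eight_le_ceil
  rw [card_smallBoxes (by omega)]
  have := Nat.floor_le_ceil ((n : ℝ) ^ (1 / 5626 : ℝ))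
  omega

lemma smallSD_pos (h : IsNBU D) (hn : IsLarge n) : 0 < smallSD D n := by
  have := h.expectedMax_pos (m := ⌊(n : ℝ) ^ (1 / 5626 : ℝ)⌋₊) (by have := hn.eight_le; omega)
  have := hn.sqrt_pos
  unfold smallSD
  positivity

lemma hardSD_mem_smallNoiseMHR (h : IsNBU D) (hn : IsLarge n) :
    hardSD D n ∈ smallNoiseMHR D n (1 / 5626) := by
  have hs := smallSD_pos h hn
  have hS : smallSD D n ≤ n * mean D + smallSD D n := by
    have := h.mean_pos
    exact le_add_of_nonneg_left (by positivity)
  have h1 := hn.two_mul_le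
  have h2 := hn.eight_le_ceil
  -- Entry number `M` has index `M - 1`, the last small box; the noise bound holds there with
  -- equality.
  refine ⟨twoScale_nonneg hs.le hS, monotone_twoScale hs.le hS,
    ⟨⌈(n : ℝ) ^ (1 / 5626 : ℝ)⌉₊ - 1, by omega⟩, by simp only; omega, ?_⟩
  rw [hardSD, twoScale_small (by rw [mem_smallBoxes]; simp only; omega)]
  rfl

/-- By the choice of `s`, the level `E/10` is `9w/5` standard deviations, and `(9/5)² > 2`. -/
lemma exp_neg_tenth_le (hn : IsLarge n) (h : IsNBU D) :
    Real.exp (-(1 / 10 * expectedMax D ⌊(n : ℝ) ^ (1 / 5626 : ℝ)⌋₊) ^ 2 / (2 * smallSD D n ^ 2)) ≤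
      1 / (⌊(n : ℝ) ^ (1 / 5626 : ℝ)⌋₊ : ℝ) ^ 2 := by
  have hE := h.expectedMax_pos (m := ⌊(n : ℝ) ^ (1 / 5626 : ℝ)⌋₊)
    (by have := hn.eight_le; omega)
  have hw := hn.sqrt_pos
  refine le_trans (le_of_eq ?_) hn.exp_le
  congr 1
  unfold smallSD
  generalize √(2 * (1 / 5626) * Real.log n) = w at hw ⊢
  field_simp
  norm_num

lemma reward_hardSD_le (h : IsNBU D) (hn : IsLarge n) {A : Policy n}
    {γ : (Fin n → ℝ) → (Fin n → ℝ) → ℝ} (hA : A.IsLinear γ) :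
    reward D (hardSD D n) A ≤ 16 * mean D := by
  have hs := smallSD_pos h hn
  have hμ := h.mean_pos
  have hn0 : 0 < n := by have := hn.one_lt; omega
  have hn0' : (0 : ℝ) < n := by exact_mod_cast hn0
  have hm8 := hn.eight_le
  have hM8 := hn.eight_le_ceil
  have h2M := hn.two_mul_le
  have hw := hn.sqrt_pos
  have hcard := hn.card_smallBoxes_le
  have htail := h.tail_mul_expectedMax_le (m := ⌊(n : ℝ) ^ (1 / 5626 : ℝ)⌋₊) (by omega) 2
  have hexp := exp_neg_tenth_le hn h
  have hE := h.expectedMax_pos (m := ⌊(n : ℝ) ^ (1 / 5626 : ℝ)⌋₊) (by omega)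
  have hpow := hn.pow_le
  -- The factor `297/5 = 18 · 33/10` makes `s u = 33E/10`: twice `8E/5`, which a reward exceeds with
  -- probability at most `1/m²`, plus `E/10` for the noise.
  have hsu : smallSD D n * (297 / 5 * √(2 * (1 / 5626) * Real.log n)) =
      2 * (8 / 5 * expectedMax D ⌊(n : ℝ) ^ (1 / 5626 : ℝ)⌋₊) +
        1 / 10 * expectedMax D ⌊(n : ℝ) ^ (1 / 5626 : ℝ)⌋₊ := by
    unfold smallSD
    generalize √(2 * (1 / 5626) * Real.log n) = w at hw ⊢
    field_simp
    norm_num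
  set m := ⌊(n : ℝ) ^ (1 / 5626 : ℝ)⌋₊
  set M := ⌈(n : ℝ) ^ (1 / 5626 : ℝ)⌉₊
  set E := expectedMax D m
  set s := smallSD D n
  set S := n * mean D + s with hS
  have hm0 : (0 : ℝ) < m := by exact_mod_cast (by omega : 0 < m)
  have hsS : s ≤ S := le_add_of_nonneg_left (by positivity)
  have hS0 : 0 < S := hs.trans_le hsS
  -- `K = mμ` balances the second moments of about `m` small boxes against an event of probability
  -- at most `3/m`: both terms become multiples of `μ`.
  have h1 := reward_le_of_isLinear (u := 297 / 5 * √(2 * (1 / 5626) * Real.log n)) (M := M) h hA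
    hn0 hs hsS (K := m * mean D) (by positivity)
  rw [hsu] at h1
  have h2 := measureReal_smallSelectable_le (D := D) (s := s) (S := S) (a := 2 * (8 / 5 * E))
    (b := 1 / 10 * E) (by omega : 0 < M) (by omega : M ≤ n) hS0 (by positivity)
    (u := 297 / 5 * √(2 * (1 / 5626) * Real.log n)) (by positivity)
  have hP : (law D (twoScale n M s S)).real (smallSelectable n M (2 * (8 / 5 * E) + 1 / 10 * E)
      (S * (297 / 5 * √(2 * (1 / 5626) * Real.log n)))) ≤ 3 / m := by
    refine h2.trans ?_
    rw [← card_smallBoxes (by omega : M ≤ n)]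
    calc _ ≤ (m : ℝ) * (1 / m ^ 2 + 1 / m ^ 2) + 1 / m := by
          gcongr
          rw [← one_div_pow]
          exact_mod_cast htail
      _ = 3 / m := by field_simp; norm_num
  -- This is where `S ≥ nμ` is needed.
  have b1 : n * (8 * mean D ^ 2 / S) ≤ 8 * mean D := by
    rw [← mul_div_assoc, div_le_iff₀ hS0, hS]
    nlinarith [mul_pos hμ hs]
  have b2 : (smallBoxes n M).card * (8 * mean D ^ 2 / (2 * (m * mean D))) ≤ 4 * mean D := by
    calc _ ≤ (m : ℝ) * (8 * mean D ^ 2 / (2 * (m * mean D))) := by gcongr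
      _ = 4 * mean D := by field_simp; norm_num
  have b3 : m * mean D / 2 * (law D (twoScale n M s S)).real (smallSelectable n M
      (2 * (8 / 5 * E) + 1 / 10 * E) (S * (297 / 5 * √(2 * (1 / 5626) * Real.log n)))) ≤
      3 / 2 * mean D := by
    calc _ ≤ m * mean D / 2 * (3 / m) := by gcongr
      _ = _ := by field_simp
  have : reward D (hardSD D n) A = reward D (twoScale n M s S) A := rfl
  linarith

end Hard

/-! ### Independence of the observations -/

section Independence

variable (D : Measure ℝ) [IsProbabilityMeasure D] {n : ℕ} (σ : Fin n → ℝ)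

lemma measurePreserving_pair (i : Fin n) :
    MeasurePreserving (fun ω : (Fin n → ℝ) × (Fin n → ℝ) => (ω.1 i, ω.2 i)) (law D σ)
      (D.prod (gaussianReal 0 (Real.toNNReal (σ i ^ 2)))) :=
  (measurePreserving_eval (fun _ : Fin n => D) i).prod
    (measurePreserving_eval (fun i : Fin n => gaussianReal 0 (Real.toNNReal (σ i ^ 2))) i)

lemma iIndepFun_pair :
    iIndepFun (fun (i : Fin n) (ω : (Fin n → ℝ) × (Fin n → ℝ)) => (ω.1 i, ω.2 i)) (law D σ) := by
  rw [iIndepFun_iff_map_fun_eq_pi_map fun i => (measurePreserving_pair D σ i).measurable.aemeasurable]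
  simp only [(measurePreserving_pair D σ _).map_eq]
  exact ((measurePreserving_arrowProdEquivProdArrow ℝ ℝ (Fin n) (fun _ => D)
    fun i => gaussianReal 0 (Real.toNNReal (σ i ^ 2))).symm _).map_eq

lemma measurable_Y (i : Fin n) : Measurable (Y i) := by
  unfold Y; fun_prop

lemma iIndepFun_Y : iIndepFun (fun i : Fin n => Y i) (law D σ) :=
  (iIndepFun_pair D σ).comp (fun _ p => p.1 + p.2) fun _ => by fun_prop

end Independence

/-! ### Lower bound on the optimal reward by a threshold rule -/

section Optimal

variable {D : Measure ℝ} [IsProbabilityMeasure D] {n : ℕ} (σ : Fin n → ℝ)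

/-- The expected value of a box given its observation. -/
noncomputable def posterior (D : Measure ℝ) {n : ℕ} (σ : Fin n → ℝ) (i : Fin n) :
    (Fin n → ℝ) × (Fin n → ℝ) → ℝ :=
  (law D σ)[X i | MeasurableSpace.comap (Y i) inferInstance]

lemma posterior_nonneg (h : IsNBU D) : ∀ᵐ ω ∂law D σ, ∀ i, 0 ≤ posterior D σ i ω := by
  refine ae_all_iff.2 fun i => condExp_nonneg ?_
  filter_upwards [ae_X σ h.ae_nonneg] with ω hω using hω i

/-- All boxes of `T` before box `i` have an observation below `θ`. -/
def firstAbove (T : Finset (Fin n)) (θ : ℝ) (i : Fin n) : Set ((Fin n → ℝ) × (Fin n → ℝ)) :=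
  {ω | ∀ j ∈ T, j < i → Y j ω < θ}

lemma measurableSet_firstAbove (T : Finset (Fin n)) (θ : ℝ) (i : Fin n) :
    MeasurableSet (firstAbove T θ i) := by
  unfold firstAbove
  simp only [ofPred_forall]
  exact Finset.measurableSet_biInter _ fun j _ => MeasurableSet.iInter fun _ =>
    measurableSet_lt (measurable_Y j) measurable_const

lemma indep_firstAbove (T : Finset (Fin n)) (θ : ℝ) (i : Fin n)
    {F : (Fin n → ℝ) × (Fin n → ℝ) → ℝ}
    (hF : Measurable[MeasurableSpace.comap (Y i) inferInstance] F) :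
    IndepFun F ((firstAbove T θ i).indicator fun _ => (1 : ℝ)) (law D σ) := by
  classical
  have h1 := (iIndepFun_Y D σ).indepFun_finset {i} (T.filter (· < i))
    (by simp) measurable_Y
  have h2 : MeasurableSpace.comap F inferInstance ≤
      MeasurableSpace.comap (fun ω (j : ({i} : Finset (Fin n))) => Y (j : Fin n) ω)
        inferInstance := by
    refine hF.comap_le.trans ?_
    have : Y i = (fun v : ({i} : Finset (Fin n)) → ℝ => v ⟨i, by simp⟩) ∘
      (fun ω (j : ({i} : Finset (Fin n))) => Y (j : Fin n) ω) := rfl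
    rw [this, ← MeasurableSpace.comap_comp]
    exact MeasurableSpace.comap_mono (Measurable.comap_le (by fun_prop))
  have h3 : MeasurableSpace.comap ((firstAbove T θ i).indicator fun _ => (1 : ℝ)) inferInstance ≤
      MeasurableSpace.comap (fun ω (j : T.filter (· < i)) => Y (j : Fin n) ω) inferInstance := by
    refine Measurable.comap_le ?_
    refine Measurable.indicator measurable_const ?_
    refine ⟨{v | ∀ j, v j < θ}, ?_, ?_⟩
    · simp only [ofPred_forall]
      exact MeasurableSet.iInter fun j => measurableSet_lt (by fun_prop) measurable_const
    · ext ω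
      simp [firstAbove]
  exact indep_of_indep_of_le_left (indep_of_indep_of_le_right h1 h3) h2

lemma integral_posterior_le_optReward (h : IsNBU D) (hn : 0 < n) (T : Finset (Fin n)) (θ : ℝ) :
    ∑ i ∈ T, ∫ ω, (Y i ⁻¹' Ici θ ∩ firstAbove T θ i).indicator (posterior D σ i) ω ∂law D σ ≤
      optReward D σ := by
  have : Nonempty (Fin n) := ⟨⟨0, hn⟩⟩
  have hi : ∀ i ∈ T, Integrable ((Y i ⁻¹' Ici θ ∩ firstAbove T θ i).indicator (posterior D σ i))
      (law D σ) := fun i _ => integrable_condExp.indicator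
        ((measurable_Y i measurableSet_Ici).inter (measurableSet_firstAbove T θ i))
  rw [← integral_finsetSum _ hi]
  refine integral_mono_ae (integrable_finsetSum _ hi)
    (integrable_iSup fun i => integrable_condExp) ?_
  filter_upwards [posterior_nonneg σ h] with ω hω
  have hb : BddAbove (range fun i => posterior D σ i ω) := (finite_range _).bddAbove
  -- At most one box is the first to reach the threshold, so the sum is a single posterior or zero;
  -- in the latter case posteriors being non-negative suffices.
  by_cases hex : ∃ i ∈ T, ω ∈ Y i ⁻¹' Ici θ ∩ firstAbove T θ i
  · obtain ⟨i, hi, hmem⟩ := hex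
    rw [Finset.sum_eq_single i]
    · rw [indicator_of_mem hmem]
      exact le_ciSup hb i
    · intro j hj hji
      refine indicator_of_notMem (fun hj' => ?_) _
      rcases lt_or_gt_of_ne hji with hlt | hlt
      · exact not_lt.2 hj'.1 (hmem.2 j hj hlt)
      · exact not_lt.2 hmem.1 (hj'.2 i hi hlt)
    · exact fun hi' => absurd hi hi'
  · rw [Finset.sum_eq_zero fun i hi => indicator_of_notMem (fun hm => hex ⟨i, hi, hm⟩) _]
    exact (hω ⟨0, hn⟩).trans (le_ciSup hb _)

/-- The posterior of box `i` and the event `Y i ≥ θ` depend on `Y i` alone, hence are independent of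
the earlier observations. The posterior then integrates like `X i` over an event determined by `Y
i`. -/
lemma integral_posterior_firstAbove (h : IsNBU D) (T : Finset (Fin n)) (θ : ℝ) (i : Fin n) :
    ∫ ω, (Y i ⁻¹' Ici θ ∩ firstAbove T θ i).indicator (posterior D σ i) ω ∂law D σ =
      (∫ ω in Y i ⁻¹' Ici θ, X i ω ∂law D σ) * (law D σ).real (firstAbove T θ i) := by
  have hm : MeasurableSet[MeasurableSpace.comap (Y i) inferInstance] (Y i ⁻¹' Ici θ) :=
    ⟨_, measurableSet_Ici, rfl⟩
  have hle : MeasurableSpace.comap (Y i) inferInstance ≤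
      (inferInstance : MeasurableSpace ((Fin n → ℝ) × (Fin n → ℝ))) := (measurable_Y i).comap_le
  have hZ : Measurable[MeasurableSpace.comap (Y i) inferInstance]
      ((Y i ⁻¹' Ici θ).indicator (posterior D σ i)) :=
    (stronglyMeasurable_condExp.measurable).indicator hm
  have hind := (indep_firstAbove (D := D) σ T θ i hZ).integral_mul_eq_mul_integral
    (hZ.mono hle le_rfl).aestronglyMeasurable
    ((measurable_const.indicator (measurableSet_firstAbove T θ i)).aestronglyMeasurable)
  have e : ∀ ω, (Y i ⁻¹' Ici θ ∩ firstAbove T θ i).indicator (posterior D σ i) ω =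
      ((Y i ⁻¹' Ici θ).indicator (posterior D σ i) *
        (firstAbove T θ i).indicator fun _ => (1 : ℝ)) ω := by
    intro ω
    by_cases h1 : ω ∈ Y i ⁻¹' Ici θ <;> by_cases h2 : ω ∈ firstAbove T θ i <;>
      simp [indicator, h1, h2]
  rw [integral_congr_ae (Eventually.of_forall e), hind,
    integral_indicator_const _ (measurableSet_firstAbove T θ i), smul_eq_mul, mul_one,
    integral_indicator (hle _ hm)]
  congr 1
  exact setIntegral_condExp hle (integrable_comp_X σ i h.integrable_id) hm

lemma measureReal_obs_firstAbove (T : Finset (Fin n)) (θ : ℝ) (i : Fin n) :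
    (law D σ).real (Y i ⁻¹' Ici θ ∩ firstAbove T θ i) =
      (law D σ).real (Y i ⁻¹' Ici θ) * (law D σ).real (firstAbove T θ i) := by
  have hm : MeasurableSet[MeasurableSpace.comap (Y i) inferInstance] (Y i ⁻¹' Ici θ) :=
    ⟨_, measurableSet_Ici, rfl⟩
  have hF : Measurable[MeasurableSpace.comap (Y i) inferInstance]
      ((Y i ⁻¹' Ici θ).indicator fun _ => (1 : ℝ)) := Measurable.indicator measurable_const hm
  have hind := (indep_firstAbove (D := D) σ T θ i hF).measure_inter_preimage_eq_mul {1} {1} (measurableSet_singleton _) (measurableSet_singleton _)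
  have e : ∀ A : Set ((Fin n → ℝ) × (Fin n → ℝ)),
      (A.indicator fun _ => (1 : ℝ)) ⁻¹' {1} = A := fun A => by
    ext ω; by_cases hω : ω ∈ A <;> simp [hω]
  rw [e, e] at hind
  simp only [measureReal_def, hind, ENNReal.toReal_mul]

/-- A lower bound on the optimal reward when the observation of each box in `T` is at least `θ`
with probability at least `q`, and then the expected value of the box is at least `κ`. -/
lemma le_optReward (h : IsNBU D) (hn : 0 < n) (T : Finset (Fin n)) {θ κ q : ℝ} (hκ : 0 ≤ κ)
    (hq : ∀ i ∈ T, q ≤ (law D σ).real (Y i ⁻¹' Ici θ))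
    (hX : ∀ i ∈ T, κ * (law D σ).real (Y i ⁻¹' Ici θ) ≤ ∫ ω in Y i ⁻¹' Ici θ, X i ω ∂law D σ) :
    κ * (1 - (1 - q) ^ T.card) ≤ optReward D σ := by
  refine le_trans ?_ (integral_posterior_le_optReward σ h hn T θ)
  have h1 : (law D σ).real (⋂ i ∈ T, Y i ⁻¹' Iio θ) ≤ (1 - q) ^ T.card := by
    rw [measureReal_def, (iIndepFun_Y D σ).measure_inter_preimage_eq_mul T
      (fun _ _ => measurableSet_Iio), ENNReal.toReal_prod]
    refine (Finset.prod_le_prod (fun _ _ => ENNReal.toReal_nonneg) fun i hi => ?_).trans_eq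
      (Finset.prod_const _)
    have := probReal_compl_eq_one_sub (μ := law D σ) (measurable_Y i (measurableSet_Ici (a := θ)))
    rw [← preimage_compl, compl_Ici] at this
    rw [← measureReal_def, this]
    linarith [hq i hi]
  have h2 : (⋂ i ∈ T, Y i ⁻¹' Iio θ)ᶜ ⊆ ⋃ i ∈ T, (Y i ⁻¹' Ici θ ∩ firstAbove T θ i) := by
    classical
    intro ω hω
    simp only [mem_compl_iff, mem_iInter, mem_preimage, mem_Iio, not_forall, not_lt] at hω
    obtain ⟨j, hj, hjθ⟩ := hω
    have hne : (T.filter fun i => θ ≤ Y i ω).Nonempty := ⟨j, by simp [hj, hjθ]⟩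
    have hmin := Finset.min'_mem _ hne
    set i := (T.filter fun i => θ ≤ Y i ω).min' hne
    rw [Finset.mem_filter] at hmin
    refine mem_iUnion₂.2 ⟨i, hmin.1, hmin.2, fun k hk hki => ?_⟩
    by_contra! hc
    exact absurd (Finset.min'_le _ k (by simp [hk, hc])) (not_le.2 hki)
  have hm : MeasurableSet (⋂ i ∈ T, Y i ⁻¹' Iio θ) :=
    Finset.measurableSet_biInter _ fun i _ => measurable_Y i measurableSet_Iio
  have h3 := (measureReal_mono h2 (measure_ne_top (law D σ) _)).trans (measureReal_biUnion_finset_le _ _)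
  rw [probReal_compl_eq_one_sub hm] at h3
  calc κ * (1 - (1 - q) ^ T.card)
      ≤ κ * ∑ i ∈ T, (law D σ).real (Y i ⁻¹' Ici θ ∩ firstAbove T θ i) := by
        gcongr; linarith
    _ = ∑ i ∈ T, κ * (law D σ).real (Y i ⁻¹' Ici θ) * (law D σ).real (firstAbove T θ i) := by
        rw [Finset.mul_sum]
        simp only [measureReal_obs_firstAbove, mul_assoc]
    _ ≤ _ := by
        refine Finset.sum_le_sum fun i hi => ?_
        rw [integral_posterior_firstAbove σ h]
        gcongr
        exact hX i hi

lemma le_measureReal_obs_ge (θ : ℝ) (i : Fin n) :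
    D.real (Ioi θ) / 2 ≤ (law D σ).real (Y i ⁻¹' Ici θ) := by
  have hp := measurePreserving_pair D σ i
  have hsub : (fun ω : (Fin n → ℝ) × (Fin n → ℝ) => (ω.1 i, ω.2 i)) ⁻¹' (Ioi θ ×ˢ Ici 0) ⊆
      Y i ⁻¹' Ici θ := by
    rintro ω ⟨h1, h2⟩
    simp only [mem_Ioi, mem_Ici] at h1 h2
    simp only [mem_preimage, mem_Ici, Y]
    linarith
  refine le_trans ?_ (measureReal_mono hsub)
  rw [measureReal_def (law D σ), hp.measure_preimage
    (measurableSet_Ioi.prod measurableSet_Ici).nullMeasurableSet, Measure.prod_prod,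
    ENNReal.toReal_mul, div_eq_mul_one_div]
  exact mul_le_mul_of_nonneg_left (half_le_gaussianReal_Ici_zero _) measureReal_nonneg

/-- When `Y i ≥ θ` and the noise is below `b`, the reward exceeds `θ - b`; noise of at least `b` has
small probability. -/
lemma le_setIntegral_obs_ge (h : IsNBU D) {θ b : ℝ} (hb : 0 ≤ b) (i : Fin n) (hbθ : b ≤ θ) :
    (θ - b) * ((law D σ).real (Y i ⁻¹' Ici θ) - Real.exp (-b ^ 2 / (2 * σ i ^ 2))) ≤
      ∫ ω in Y i ⁻¹' Ici θ, X i ω ∂law D σ := by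
  have hB := measurable_Y i (measurableSet_Ici (a := θ))
  set N : Set ((Fin n → ℝ) × (Fin n → ℝ)) := (fun ω => ω.2 i) ⁻¹' Ici b
  have hN : MeasurableSet N := (measurePreserving_eps D σ i).measurable measurableSet_Ici
  have h1 : (law D σ).real N ≤ Real.exp (-b ^ 2 / (2 * σ i ^ 2)) := by
    rw [measureReal_def,
      (measurePreserving_eps D σ i).measure_preimage measurableSet_Ici.nullMeasurableSet]
    exact gaussianReal_Ici_le hb
  have h2 : (law D σ).real (Y i ⁻¹' Ici θ) - Real.exp (-b ^ 2 / (2 * σ i ^ 2)) ≤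
      (law D σ).real (Y i ⁻¹' Ici θ \ N) := by
    have := le_measureReal_sdiff (μ := law D σ) (s₁ := Y i ⁻¹' Ici θ) (s₂ := N)
    linarith
  calc _ ≤ (θ - b) * (law D σ).real (Y i ⁻¹' Ici θ \ N) :=
        mul_le_mul_of_nonneg_left h2 (by linarith)
    _ = ∫ ω in Y i ⁻¹' Ici θ \ N, (θ - b) ∂law D σ := by
        rw [setIntegral_const, smul_eq_mul, mul_comm]
    _ ≤ ∫ ω in Y i ⁻¹' Ici θ \ N, X i ω ∂law D σ := by
        refine setIntegral_mono_on (integrable_const _)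
          (integrable_comp_X σ i h.integrable_id).integrableOn (hB.diff hN) fun ω hω => ?_
        have h3 : θ ≤ ω.1 i + ω.2 i := hω.1
        have h4 : ω.2 i < b := not_le.1 hω.2
        unfold X
        linarith
    _ ≤ _ := by
        refine setIntegral_mono_set (integrable_comp_X σ i h.integrable_id).integrableOn ?_
          (Eventually.of_forall fun _ hω => hω.1)
        exact ae_restrict_of_ae ((ae_X σ h.ae_nonneg).mono fun ω hω => hω i)

end Optimal

/-! ### Comparison on the hard instance -/

section Hard

variable {D : Measure ℝ} [IsProbabilityMeasure D] {n : ℕ}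

lemma expectedMax_le_optReward_hardSD (h : IsNBU D) (hn : IsLarge n) :
    expectedMax D ⌊(n : ℝ) ^ (1 / 5626 : ℝ)⌋₊ / 50 ≤ optReward D (hardSD D n) := by
  have hm8 := hn.eight_le
  have hexp := exp_neg_tenth_le hn h
  have hcard := hn.le_card_smallBoxes
  have htail := h.le_tail_half_expectedMax (m := ⌊(n : ℝ) ^ (1 / 5626 : ℝ)⌋₊) (by omega)
  have hE := h.expectedMax_pos (m := ⌊(n : ℝ) ^ (1 / 5626 : ℝ)⌋₊) (by omega)
  have hn0 : 0 < n := by have := hn.one_lt; omega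
  have hσ : ∀ i ∈ smallBoxes n ⌈(n : ℝ) ^ (1 / 5626 : ℝ)⌉₊, hardSD D n i = smallSD D n :=
    fun i hi => twoScale_small hi
  set m := ⌊(n : ℝ) ^ (1 / 5626 : ℝ)⌋₊
  set T := smallBoxes n ⌈(n : ℝ) ^ (1 / 5626 : ℝ)⌉₊
  set E := expectedMax D m
  have hm0 : (8 : ℝ) ≤ m := by exact_mod_cast hm8
  have hq : ∀ i ∈ T, 1 / (4 * m : ℝ) ≤ (law D (hardSD D n)).real (Y i ⁻¹' Ici (E / 2)) := by
    intro i _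
    refine le_trans ?_ (le_measureReal_obs_ge (hardSD D n) (E / 2) i)
    rw [div_le_iff₀ (by positivity)]
    linarith
  -- At least `m - 1 ≥ 7m/8` boxes each pass with probability at least `1/(4m)`, so none passes with
  -- probability at most `exp(-7/32) ≤ 9/10`, leaving `E/5 · 1/10`.
  refine le_trans ?_ (le_optReward (hardSD D n) h hn0 T (θ := E / 2) (κ := E / 5)
    (q := 1 / (4 * m)) (by positivity) hq fun i hi => ?_)
  · have hq1 : 1 / (4 * m : ℝ) ≤ 1 := by
      rw [div_le_one (by positivity)]; linarith
    have hpow : (1 - 1 / (4 * m : ℝ)) ^ T.card ≤ Real.exp (-(7 / 32)) := by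
      calc (1 - 1 / (4 * m : ℝ)) ^ T.card ≤ Real.exp (-(1 / (4 * m))) ^ T.card := by
            refine pow_le_pow_left₀ (by linarith) ?_ _
            linarith [Real.add_one_le_exp (-(1 / (4 * m : ℝ)))]
        _ = Real.exp (-(T.card * (1 / (4 * m)))) := by rw [← Real.exp_nat_mul]; ring_nf
        _ ≤ _ := by
            have : (m : ℝ) ≤ T.card + 1 := by exact_mod_cast hcard
            gcongr
            rw [mul_one_div, div_le_div_iff₀ (by norm_num) (by positivity)]
            linarith
    have hexp' : Real.exp (-(7 / 32)) ≤ 9 / 10 := by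
      rw [Real.exp_neg]
      refine inv_le_of_inv_le₀ (by norm_num) ?_
      have := Real.add_one_le_exp (7 / 32)
      norm_num at this ⊢
      linarith
    nlinarith
  · refine le_trans ?_ (le_setIntegral_obs_ge (hardSD D n) h (b := 1 / 10 * E) (by positivity) i
      (by linarith))
    rw [hσ i hi]
    have h1 := hq i hi
    -- As `m ≥ 8`, large noise takes away at most half of the passing probability, so the
    -- conditional mean is at least `(E/2 - E/10)/2 = E/5`.
    have h2 : 1 / (m : ℝ) ^ 2 ≤ 1 / (4 * m) / 2 := by
      rw [div_div, div_le_div_iff₀ (by positivity) (by positivity)]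
      nlinarith
    set P := (law D (hardSD D n)).real (Y i ⁻¹' Ici (E / 2))
    have h3 : P / 2 ≤ P - Real.exp (-(1 / 10 * E) ^ 2 / (2 * smallSD D n ^ 2)) := by linarith
    have h4 := mul_le_mul_of_nonneg_left h3 (show 0 ≤ E / 2 - 1 / 10 * E by linarith)
    refine le_trans (le_of_eq ?_) h4
    ring

lemma reward_le_optReward_hardSD (h : IsNBU D) (hn : IsLarge n) {A : Policy n}
    {γ : (Fin n → ℝ) → (Fin n → ℝ) → ℝ} (hA : A.IsLinear γ) :
    reward D (hardSD D n) A ≤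
      20000000 * (mean D / expectedMax D n) * optReward D (hardSD D n) := by
  have hn0 : 0 < n := by have := hn.one_lt; omega
  have hEn := h.expectedMax_pos hn0
  have hμ := h.mean_pos
  have h1 := reward_hardSD_le h hn hA
  have h2 := expectedMax_le_optReward_hardSD h hn
  have h3 := h.expectedMax_le_of_le_pow (by have := hn.eight_le; omega) hn0 hn.le_pow
  push_cast at h3
  -- The factor is `(2 · 11252 + 1) · 50 = 1125250`, rounded up.
  have h4 : expectedMax D n ≤ 1250000 * optReward D (hardSD D n) := by linarith
  calc reward D (hardSD D n) A ≤ 16 * (mean D / expectedMax D n) * expectedMax D n := by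
        rw [mul_assoc, div_mul_cancel₀ _ hEn.ne']; exact h1
    _ ≤ 16 * (mean D / expectedMax D n) * (1250000 * optReward D (hardSD D n)) := by gcongr
    _ = _ := by ring

end Hard

end NoisyBoxes

/-! ### The main theorem -/

theorem mainTheorem3 :
    ∃ (C κ : ℝ) (n₀ : ℕ), 0 < C ∧ 0 < κ ∧
      (∀ (D : MeasureTheory.Measure ℝ) [MeasureTheory.IsProbabilityMeasure D],
        NoisyBoxes.IsMHR D → ∀ n : ℕ, n₀ ≤ n →
          ∃ σ ∈ NoisyBoxes.smallNoiseMHR D n (1 / 5626),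
            ∀ (γ : (Fin n → ℝ) → (Fin n → ℝ) → ℝ) (A : NoisyBoxes.Policy n), A.IsLinear γ →
              NoisyBoxes.reward D σ A ≤
                C * (NoisyBoxes.mean D / NoisyBoxes.expectedMax D n) *
                  NoisyBoxes.optReward D σ) ∧
      (∀ r : ℝ, 0 < r → ∀ n : ℕ, n₀ ≤ n →
          ∃ σ ∈ NoisyBoxes.smallNoiseMHR (ProbabilityTheory.expMeasure r) n (1 / 5626),
            ∀ (γ : (Fin n → ℝ) → (Fin n → ℝ) → ℝ) (A : NoisyBoxes.Policy n), A.IsLinear γ →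
              κ * Real.log n * NoisyBoxes.reward (ProbabilityTheory.expMeasure r) σ A ≤
                NoisyBoxes.optReward (ProbabilityTheory.expMeasure r) σ) := by
  obtain ⟨n₀, hn₀⟩ := Filter.eventually_atTop.1 NoisyBoxes.eventually_isLarge
  -- `C = 16 · 1250000`. For exponentials the mean is at most `2 / ln n` times the expected maximum,
  -- whence `κ = 1 / (2C)`.
  refine ⟨20000000, 1 / 40000000, n₀, by norm_num, by norm_num, fun D _ hD n hn => ?_,
    fun r hr n hn => ?_⟩
  · exact ⟨_, NoisyBoxes.hardSD_mem_smallNoiseMHR hD.isNBU (hn₀ n hn),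
      fun _ _ hA => NoisyBoxes.reward_le_optReward_hardSD hD.isNBU (hn₀ n hn) hA⟩
  · have := ProbabilityTheory.isProbabilityMeasure_expMeasure hr
    have hL := hn₀ n hn
    have hD := (NoisyBoxes.isMHR_expMeasure hr).isNBU
    refine ⟨_, NoisyBoxes.hardSD_mem_smallNoiseMHR hD hL, fun γ A hA => ?_⟩
    have hn0 : 0 < n := by have := hL.one_lt; omega
    have h1 := NoisyBoxes.reward_le_optReward_hardSD hD hL hA
    have h2 := NoisyBoxes.le_expectedMax_expMeasure hr hn0
    have hE := hD.expectedMax_pos hn0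
    have hlog : 0 < Real.log n := Real.log_pos (by exact_mod_cast hL.one_lt)
    have hopt : 0 ≤ NoisyBoxes.optReward (ProbabilityTheory.expMeasure r)
        (NoisyBoxes.hardSD (ProbabilityTheory.expMeasure r) n) :=
      le_trans (by have := hD.expectedMax_pos (m := ⌊(n : ℝ) ^ (1 / 5626 : ℝ)⌋₊)
                     (by have := hL.eight_le; omega)
                   positivity) (NoisyBoxes.expectedMax_le_optReward_hardSD hD hL)
    rw [NoisyBoxes.mean_expMeasure hr] at h1
    have h3 : Real.log n * (1 / r / NoisyBoxes.expectedMax (ProbabilityTheory.expMeasure r) n) ≤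
        2 := by
      rw [div_div, mul_one_div, div_le_iff₀ (by positivity)]
      rw [div_le_iff₀ (by positivity)] at h2
      linarith
    calc _ ≤ 1 / 40000000 * Real.log n * _ := mul_le_mul_of_nonneg_left h1 (by positivity)
      _ = 1 / 2 * (Real.log n * (1 / r / NoisyBoxes.expectedMax
            (ProbabilityTheory.expMeasure r) n)) * NoisyBoxes.optReward _ _ := by ring
      _ ≤ 1 / 2 * 2 * NoisyBoxes.optReward _ _ := by gcongr
      _ = _ := by ring
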